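/- **Conventions.** Let $\mathcal H=\{\operatorname{Re} z>0\}$ and, for $R>0$, $Q_R=\{0<\operatorname{Re} z<2R,\ -R<\operatorname{Im} z<R\}$. A *tract model* $(\tau,\Omega)$ is an unbounded simply connected domain $\Omega\subset\mathbb C$ with a conformal isomorphism $\tau:\Omega\to\mathcal H$ whose inverse $\varphi=\tau^{-1}$ satisfies $|\varphi(z)|\to\infty$ as $z\to\infty$ in $\mathcal H$. Put $\Omega_R=\varphi(Q_R)$ and $\varphi_R(z)=\varphi(Rz)$. The tract is *Hölder* if there are $H>0$ and $0<\alpha\le 1$ such that for every $\kappa\in(0,1)$ there are $m>0$ and $R_0\ge 1$ such that for all $R\ge R_0$: 1. $|\varphi_R(z_1)-\varphi_R(z_2)|\le H\,|\varphi_R'(1)|\,|z_1-z_2|^{\alpha}$ for all $z_1,z_2\in Q_1$; 2. $|\varphi_R(z)|\ge m\operatorname{diam}(\Omega_R)$ for all $z\in Q_1\setminus Q_\kappa$. With $g_R=\varphi_R/\operatorname{diam}(\Omega_R)$ and $\kappa=1/(1+2\pi)$, put for $t\ge 0$ $$I_R(t)=\max\Big\{\int_{-1}^{-\kappa}|g_R'(\tfrac1R+iy)|^t\,dy,\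 \int_{\kappa}^{1}|g_R'(\tfrac1R+iy)|^t\,dy\Big\},\qquad \beta_\infty(t)=\limsup_{R\to\infty}\frac{\log I_R(t)}{\log R}.$$ A *logarithmic tract over infinity* of a meromorphic function $f$ is an unbounded simply connected domain $\Omega$ such that for some $R>0$ the restriction $f:\Omega\to\{|z|>R\}$ is a (universal) covering. Then $f=Re^{\tau}$ on $\Omega$ for a conformal isomorphism $\tau:\Omega\to\mathcal H$, unique up to adding an integer multiple of $2\pi i$; the tract is called Hölder if $(\tau,\Omega)$ is a Hölder tract model, and $\beta_\infty$ is formed with $\varphi=\tau^{-1}$. An *expanding repeller* of $f$ is a nonempty compact set $X$ with $f(X)=X$, such that $|(f^n)'|\ge c\rho^n$ on $X$ for all $n\ge0$ with some $c>0$, $\rho>1$, and such that $X$ has an open neighbourhood, on which $f$ is holomorphic, in which $X$ is the set of all points whose entire forward orbit stays in that neighbourhood. For a meromorphic $f:\mathbb C\to\hat{\mathbb C}$, $\operatorname{HypDim}(f)$ is the supremum of the Hausdorff dimensions of the expanding repellers contained in the Julia set of $f$ (the complement of the set of points having a neighbourhood on which all iterates are defined and form a normal family). For a holomorphic $F:\Omega\to\mathbb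 C$, $\operatorname{HypDim}(F)$ is the supremum of the Hausdorff dimensions of the expanding repellers of $F$ in $\Omega$. **Theorem 4.1.** Let $(\tau,\Omega)$ be a Hölder tract model. Then $t\mapsto\beta_\infty(t)-t+1$ has a unique zero $\Theta$ in $[0,\infty)$, and $\Theta\ge 1$. If $f$ is a transcendental meromorphic function for which $\Omega$ is a logarithmic tract over infinity, with $f=Re^{\tau}$ on $\Omega$ and $R>0$ as above, then $$\operatorname{HypDim}(f)\ \ge\ \Theta\ \ge\ 1 .$$ The same holds for the local function $F=e^{\tau}$ on $\Omega$: $\operatorname{HypDim}(F)\ge\Theta\ge1$. -/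

import Mathlib

open Set Filter Topology

noncomputable section

namespace HolderTract

/-- The right half-plane `{Re z > 0}`. -/
def rightHalfPlane : Set ℂ := {z | 0 < z.re}

/-- The square `Q_R = {0 < Re z < 2R, -R < Im z < R}`. -/
def Q (R : ℝ) : Set ℂ := {z | 0 < z.re ∧ z.re < 2 * R ∧ -R < z.im ∧ z.im < R}

/-- `(τ, Ω)` is a tract model: `Ω` is an unbounded simply connected domain, `τ` is a conformal
isomorphism of `Ω` onto the right half-plane with inverse `φ`, and `φ(z) → ∞` as `z → ∞`
in the half-plane. The values of `τ` off `Ω` and of `φ` off the half-plane play no role. -/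
structure IsTractModel (Ω : Set ℂ) (τ φ : ℂ → ℂ) : Prop where
  isOpen : IsOpen Ω
  simplyConnected : SimplyConnectedSpace Ω
  unbounded : ¬ Bornology.IsBounded Ω
  holo : DifferentiableOn ℂ τ Ω
  holo_inv : DifferentiableOn ℂ φ rightHalfPlane
  mapsTo : MapsTo τ Ω rightHalfPlane
  mapsTo_inv : MapsTo φ rightHalfPlane Ω
  left_inv : ∀ z ∈ Ω, φ (τ z) = z
  right_inv : ∀ w ∈ rightHalfPlane, τ (φ w) = w
  proper : Tendsto φ (Bornology.cobounded ℂ ⊓ 𝓟 rightHalfPlane) (Bornology.cobounded ℂ)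

/-- The rescaling `φ_R (z) = φ (R z)`. -/
def rescale (φ : ℂ → ℂ) (R : ℝ) (z : ℂ) : ℂ := φ ((R : ℂ) * z)

/-- The diameter of `Ω_R = φ (Q_R)`. It is only used where this set is bounded. -/
def diamTract (φ : ℂ → ℂ) (R : ℝ) : ℝ := Metric.diam (φ '' Q R)

/-- The tract with inverse Riemann map `φ` is `(H, α)`-Hölder. -/
def IsHolderWith (φ : ℂ → ℂ) (H α : ℝ) : Prop :=
  ∀ κ : ℝ, 0 < κ → κ < 1 → ∃ m : ℝ, 0 < m ∧ ∃ R₀ : ℝ, 1 ≤ R₀ ∧ ∀ R : ℝ, R₀ ≤ R →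
    (∀ z₁ ∈ Q 1, ∀ z₂ ∈ Q 1, ‖rescale φ R z₁ - rescale φ R z₂‖ ≤
      H * ‖deriv (rescale φ R) 1‖ * ‖z₁ - z₂‖ ^ α) ∧
    (∀ z ∈ Q 1 \ Q κ, m * diamTract φ R ≤ ‖rescale φ R z‖)

/-- The tract with inverse Riemann map `φ` is Hölder. -/
def IsHolder (φ : ℂ → ℂ) : Prop :=
  ∃ H α : ℝ, 0 < H ∧ 0 < α ∧ α ≤ 1 ∧ IsHolderWith φ H α

/-- The rescaled Riemann map `g_R (z) = φ (R z) / diam Ω_R`. -/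
def g (φ : ℂ → ℂ) (R : ℝ) (z : ℂ) : ℂ := rescale φ R z / (diamTract φ R : ℂ)

/-- The constant `κ = 1 / (1 + 2π)`. -/
def kappa : ℝ := (1 + 2 * Real.pi)⁻¹

/-- The integral mean of `|g_R'| ^ t` over `{1/R + iy : a < y < b}`. -/
def segMean (φ : ℂ → ℂ) (R t a b : ℝ) : ℝ :=
  ∫ y in a..b, ‖deriv (g φ R) (((1 / R : ℝ) : ℂ) + (y : ℂ) * Complex.I)‖ ^ t

/-- `I_R (t)`: the larger of the means over the upper and over the lower segment. -/
def meanI (φ : ℂ → ℂ) (R t : ℝ) : ℝ :=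
  max (segMean φ R t (-1) (-kappa)) (segMean φ R t kappa 1)

/-- `β_R (t) = log I_R (t) / log R`. -/
def betaR (φ : ℂ → ℂ) (R t : ℝ) : ℝ := Real.log (meanI φ R t) / Real.log R

/-- The integral means spectrum at infinity `β_∞ (t) = limsup_{R → ∞} β_R (t)`,
as an extended real number, so that the upper limit always exists. -/
def betaInf (φ : ℂ → ℂ) (t : ℝ) : EReal :=
  limsup (fun R : ℝ => ((betaR φ R t : ℝ) : EReal)) atTop

/-- The poles of a meromorphic function. -/
def poles (f : ℂ → ℂ) : Set ℂ := {z | meromorphicOrderAt f z < 0}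

/-- `f` is a transcendental meromorphic function on the plane: meromorphic (in normal form, that
is, `f` is analytic off the poles, with the conventional value `0` at the poles) and not a
quotient of two polynomials. -/
def IsTranscendentalMeromorphic (f : ℂ → ℂ) : Prop :=
  MeromorphicNFOn f univ ∧
    ¬ ∃ p q : Polynomial ℂ, q ≠ 0 ∧ ∀ z, q.eval z ≠ 0 → f z = p.eval z / q.eval z

/-- `Ω` is a logarithmic tract of `f` over infinity: an unbounded simply connected domain on which
`f` restricts to a (hence universal) covering of `{|z| > R}`. There is no pole in `Ω`, as the value
at a pole is `0` by convention. -/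
structure IsLogarithmicTract (f : ℂ → ℂ) (Ω : Set ℂ) (R : ℝ) : Prop where
  pos : 0 < R
  isOpen : IsOpen Ω
  simplyConnected : SimplyConnectedSpace Ω
  unbounded : ¬ Bornology.IsBounded Ω
  mapsTo : MapsTo f Ω {w | R < ‖w‖}
  covering : IsCoveringMap mapsTo.restrict

/-- The chordal distance on the Riemann sphere. -/
def chordal : OnePoint ℂ → OnePoint ℂ → ℝ
  | some z, some w => 2 * ‖z - w‖ / (√(1 + ‖z‖ ^ 2) * √(1 + ‖w‖ ^ 2))
  | some z, none => 2 / √(1 + ‖z‖ ^ 2)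
  | none, some w => 2 / √(1 + ‖w‖ ^ 2)
  | none, none => 0

/-- The sequence `F` is a normal family on `U`: each sequence of its members has a subsequence that
converges, for the chordal distance and uniformly on compact subsets of `U`, to a map into the
sphere. -/
def IsNormalOn (F : ℕ → ℂ → ℂ) (U : Set ℂ) : Prop :=
  ∀ s : ℕ → ℕ, ∃ k : ℕ → ℕ, StrictMono k ∧ ∃ G : ℂ → OnePoint ℂ,
    ∀ K : Set ℂ, K ⊆ U → IsCompact K → ∀ ε : ℝ, 0 < ε →
      ∀ᶠ j in atTop, ∀ z ∈ K, chordal (F (s (k j)) z : OnePoint ℂ) (G z) < ε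

/-- The Fatou set: points with a neighbourhood on which all iterates are defined (no orbit meets
a pole) and form a normal family. -/
def fatou (f : ℂ → ℂ) : Set ℂ :=
  {z | ∃ U : Set ℂ, IsOpen U ∧ z ∈ U ∧ (∀ w ∈ U, ∀ n : ℕ, f^[n] w ∉ poles f) ∧
    IsNormalOn (fun n => f^[n]) U}

/-- The Julia set (in the plane). -/
def julia (f : ℂ → ℂ) : Set ℂ := (fatou f)ᶜ

/-- `X` is an expanding repeller of `f`, where `f` is holomorphic on the open set `D`: a nonempty
compact subset of `D` with `f X = X` on which the derivatives of the iterates grow uniformly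
exponentially, and which is the set of all points whose orbit stays in some neighbourhood of `X`. -/
structure IsExpandingRepeller (f : ℂ → ℂ) (D X : Set ℂ) : Prop where
  isCompact : IsCompact X
  nonempty : X.Nonempty
  image_eq : f '' X = X
  expanding : ∃ c ρ : ℝ, 0 < c ∧ 1 < ρ ∧ ∀ n : ℕ, ∀ z ∈ X, c * ρ ^ n ≤ ‖deriv f^[n] z‖
  isolated : ∃ U : Set ℂ, IsOpen U ∧ X ⊆ U ∧ U ⊆ D ∧ ∀ z, (∀ n : ℕ, f^[n] z ∈ U) → z ∈ X

/-- The hyperbolic dimension of a meromorphic function on the plane. -/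
def hypDim (f : ℂ → ℂ) : ENNReal :=
  ⨆ (X : Set ℂ) (_ : IsExpandingRepeller f (poles f)ᶜ X ∧ X ⊆ julia f), dimH X

/-- The hyperbolic dimension of a local function `F`, holomorphic on the domain `Ω`. Each of its
expanding repellers consists of points whose whole orbit stays in `Ω`. -/
def localHypDim (F : ℂ → ℂ) (Ω : Set ℂ) : ENNReal :=
  ⨆ (X : Set ℂ) (_ : IsExpandingRepeller F Ω X), dimH X

end HolderTract

end

open HolderTract

/-! Put P = R|φ'(R)|, which is comparable to diam Ω_R. If |C| is comparable to P, the inverse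
branches of λe^τ on B(C, mP/4) are w ↦ φ(log(w/λ) + 2πik), and log(w/λ) + 2πik stays within bounded
distance of the grid point log P + 2πik. On that scale the Hölder property makes φ almost constant
relative to P. Hence branch k maps the disc strictly into itself as soon as φ(log P + 2πik) is close
to C, and it scales distances by at least a fixed multiple c of A_k = |φ'(log P + 2πik)|/P. Finitely
many such branches form an iterated function system whose limit set is an expanding repeller, of
dimension at least t once Σ (cA_k)^t ≥ 1 (`eventually_isBranchSystem`, `isExpandingRepeller`,
`le_dimH`).

For grid points of height between about κR and R, φ/P lies in a fixed annulus. A number of small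
discs independent of R covers it, so by pigeonhole one disc receives a fixed fraction of Σ A_k^t.
Moving from the line Re = log P to the line Re = 1 costs only powers of log R by distortion, so Σ
A_k^t is at least R^{1-t} I_R(t) up to such powers (`segMean_le_sum`). If β_∞(t) > t - 1, this is
large for arbitrarily large R; a limsup gives no more, and a single R suffices
(`exists_repeller_of_frequently`).

The Hölder bound gives |g_R'| ≤ R^{1-α/2} on the segments, so β_∞(t) - t decreases at rate at least
α/2. This yields the unique zero Θ and β_∞(t) > t - 1 below it. That Θ ≥ 1 amounts to β_∞(1) ≥ 0:
otherwise the image of the segment from 1 + iκR to 1 + iR is so short that φ stays bounded along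
R_1/κ^n, against φ → ∞ (`beta_one_nonneg`). For meromorphic f, the repellers lie in the Julia set
because exponential growth of derivatives along a bounded orbit excludes normality (`subset_julia`).
-/

namespace HolderTract

/-! ### Bloch and Koebe theorems with explicit, non-sharp constants -/

open Metric Complex in
/-- A non-sharp version of Bloch's theorem. -/
theorem exists_ball_subset_image {f : ℂ → ℂ} {c : ℂ} {r : ℝ}
    (hf : DifferentiableOn ℂ f (ball c r)) (hr : 0 < r) (h0 : deriv f c ≠ 0) :
    ∃ w, ball w (r * ‖deriv f c‖ / 96) ⊆ f '' ball c r := by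
  have hf' : DifferentiableOn ℂ (deriv f) (ball c r) := hf.deriv isOpen_ball
  -- Maximising |f'| weighted by the distance to the circle of radius r/2 yields a point z₀ such
  -- that |f'| at most doubles on the disc of half the remaining radius.
  obtain ⟨z₀, hz₀, hmax⟩ : ∃ z₀ ∈ closedBall c (r / 2), IsMaxOn
      (fun z => (r / 2 - dist z c) * ‖deriv f z‖) (closedBall c (r / 2)) z₀ := by
    apply (isCompact_closedBall c (r / 2)).exists_isMaxOn ⟨c, by simp; positivity⟩
    apply ContinuousOn.mul (by fun_prop)
    exact (hf'.continuousOn.mono (closedBall_subset_ball (by linarith))).norm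
  have hc := hmax (mem_closedBall_self (by positivity : 0 ≤ r / 2))
  simp only [mem_ofPred_eq, dist_self, sub_zero] at hc
  set A := ‖deriv f z₀‖ with hA
  have hcpos : 0 < ‖deriv f c‖ := norm_pos_iff.2 h0
  have hprod : 0 < (r / 2 - dist z₀ c) * A := lt_of_lt_of_le (by positivity) hc
  have hA0 : 0 < A := by
    rcases (norm_nonneg (deriv f z₀)).eq_or_lt with h | h
    · rw [hA, ← h] at hprod; simp at hprod
    · exact h
  set s := (r / 2 - dist z₀ c) / 2 with hs
  have hs0 : 0 < s := by
    have := pos_of_mul_pos_left hprod hA0.le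
    simp only [hs]; linarith
  have hsub : ball z₀ s ⊆ closedBall c (r / 2) := by
    intro z hz
    have := dist_triangle z z₀ c
    simp only [mem_ball, mem_closedBall] at *
    simp only [hs] at hz hs0; linarith
  have hsub' : ball z₀ s ⊆ ball c r := hsub.trans (closedBall_subset_ball (by linarith))
  have hbd : ∀ z ∈ ball z₀ s, ‖deriv f z‖ ≤ 2 * A := by
    intro z hz
    have h1 := hmax (hsub hz)
    simp only [mem_ofPred_eq] at h1
    have h2 : s ≤ r / 2 - dist z c := by
      have := dist_triangle z z₀ c
      simp only [mem_ball] at hz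
      simp only [hs] at hz ⊢; linarith
    have h3 : s * ‖deriv f z‖ ≤ 2 * s * A := by
      calc s * ‖deriv f z‖ ≤ (r / 2 - dist z c) * ‖deriv f z‖ := by gcongr
        _ ≤ _ := h1
        _ = 2 * s * A := by simp only [hs, hA]; ring
    nlinarith
  have hmaps : MapsTo (deriv f) (ball z₀ s) (closedBall (deriv f z₀) (3 * A)) := by
    intro z hz
    rw [mem_closedBall, dist_eq_norm]
    have := norm_sub_le (deriv f z) (deriv f z₀)
    have := hbd z hz
    linarith
  -- Schwarz lemma for f' - f'(z₀), which is bounded by 3A on radius s. The radius s/6 makes the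
  -- oscillation A/2, so f is close to its linear part there.
  have hclose : ∀ z ∈ closedBall z₀ (s / 6), ‖deriv f z - deriv f z₀‖ ≤ A / 2 := by
    intro z hz
    have hz' : z ∈ ball z₀ s := closedBall_subset_ball (by linarith) hz
    have := dist_le_div_mul_dist_of_mapsTo_ball (hf'.mono hsub') hmaps hz'
    rw [← dist_eq_norm]
    rw [mem_closedBall] at hz
    calc _ ≤ _ := this
      _ ≤ 3 * A / s * (s / 6) := by gcongr
      _ = A / 2 := by field_simp; norm_num
  have hlow : ∀ z ∈ sphere z₀ (s / 6), A * s / 12 ≤ ‖f z - f z₀‖ := by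
    intro z hz
    have hd : ∀ x ∈ closedBall z₀ (s / 6), HasDerivWithinAt (fun w => f w - deriv f z₀ * w)
        (deriv f x - deriv f z₀) (closedBall z₀ (s / 6)) x := by
      intro x hx
      have hx' : x ∈ ball c r := hsub' (closedBall_subset_ball (by linarith) hx)
      have h1 := (hf.differentiableAt (isOpen_ball.mem_nhds hx')).hasDerivAt
      have h2 := (h1.sub ((hasDerivAt_id x).const_mul (deriv f z₀))).hasDerivWithinAt
        (s := closedBall z₀ (s / 6))
      rw [mul_one] at h2
      exact h2
    have := (convex_closedBall z₀ (s / 6)).norm_image_sub_le_of_norm_hasDerivWithin_le hd hclose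
      (mem_closedBall_self (by positivity)) (sphere_subset_closedBall hz)
    rw [mem_sphere_iff_norm] at hz
    rw [hz] at this
    have h2 : ‖deriv f z₀ * (z - z₀)‖ = A * (s / 6) := by rw [norm_mul, hz]
    have h3 : deriv f z₀ * (z - z₀) = (f z - f z₀) -
      ((f z - deriv f z₀ * z) - (f z₀ - deriv f z₀ * z₀)) := by ring
    rw [h3] at h2
    have h4 := norm_sub_le (f z - f z₀) ((f z - deriv f z₀ * z) - (f z₀ - deriv f z₀ * z₀))
    rw [h2] at h4
    linarith
  -- The covered disc has radius half of As/12. Since r|f'(c)|/2 ≤ 2sA, that is at least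
  -- r|f'(c)|/96.
  have hcov := DiffContOnCl.ball_subset_image_closedBall (f := f) (z₀ := z₀) (r := s / 6)
    (ε := A * s / 12)
    ((hf.mono ((closedBall_subset_ball (by linarith)).trans hsub')).diffContOnCl_ball subset_rfl)
    (by positivity) hlow (by
      have hz₀' : z₀ ∈ ball c r := hsub' (mem_ball_self hs0)
      have h1 := (hf.differentiableAt (isOpen_ball.mem_nhds hz₀')).hasDerivAt
      have h2 := h1.eventually_ne (c := f z₀) (by rwa [← norm_pos_iff])
      have h3 : ∃ᶠ z in 𝓝[≠] z₀, f z ≠ f z₀ := h2.frequently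
      exact h3.filter_mono nhdsWithin_le_nhds)
  refine ⟨f z₀, (ball_subset_ball ?_).trans (hcov.trans (image_mono
    ((closedBall_subset_ball (by linarith)).trans hsub')))⟩
  have : (r / 2 - dist z₀ c) * A = 2 * s * A := by simp only [hs]; ring
  rw [this] at hc
  linarith

open Metric Complex in
/-- A non-sharp version of the Koebe one-quarter theorem. -/
theorem mul_norm_deriv_le_of_notMem_image {f : ℂ → ℂ} {c w₀ : ℂ} {r : ℝ}
    (hf : DifferentiableOn ℂ f (ball c r)) (hinj : InjOn f (ball c r)) (hr : 0 < r)
    (hw : w₀ ∉ f '' ball c r) : r * ‖deriv f c‖ ≤ 384 * ‖f c - w₀‖ := by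
  have hne : ∀ z ∈ ball c r, f z - w₀ ≠ 0 := fun z hz h => hw ⟨z, hz, sub_eq_zero.1 h⟩
  have hcm : c ∈ ball c r := mem_ball_self hr
  by_cases h0 : deriv f c = 0
  · rw [h0]; simp
  have hf' : DifferentiableOn ℂ (deriv f) (ball c r) := hf.deriv isOpen_ball
  -- L is a branch of log(f - w₀). Injectivity of f forbids two values of L differing by 2πi, so by
  -- Bloch's theorem r|L'(c)|/96 ≤ π; the constant 384 is 96 · 4.
  obtain ⟨L, hL⟩ : ∃ L : ℂ → ℂ, ∀ z ∈ ball c r, HasDerivAt L (deriv f z / (f z - w₀)) z :=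
    (DifferentiableOn.div hf' (hf.sub_const w₀) hne).isExactOn_ball
  have hLd : DifferentiableOn ℂ L (ball c r) :=
    fun z hz => (hL z hz).differentiableAt.differentiableWithinAt
  have hLc : ‖deriv L c‖ = ‖deriv f c‖ / ‖f c - w₀‖ := by
    rw [(hL c hcm).deriv]; simp
  have hconst : ∀ z ∈ ball c r, f z - w₀ = (f c - w₀) * exp (L z - L c) := by
    intro z hz
    have hd : ∀ x ∈ ball c r, HasDerivWithinAt (fun x => (f x - w₀) * exp (- L x)) 0 (ball c r) x := by
      intro x hx
      have h1 := (hf.differentiableAt (isOpen_ball.mem_nhds hx)).hasDerivAt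
      have h2 := (h1.sub_const w₀).mul (hL x hx).neg.cexp
      have := hne x hx
      have e : (f x - w₀) * (cexp (-L x) * -(deriv f x / (f x - w₀))) =
        -(deriv f x * cexp (-L x)) := by field_simp
      exact (h2.congr_deriv (by rw [Pi.neg_apply, e, add_neg_cancel])).hasDerivWithinAt
    have := (convex_ball c r).norm_image_sub_le_of_norm_hasDerivWithin_le hd
      (C := 0) (by simp) hcm hz
    simp only [zero_mul, norm_le_zero_iff] at this
    have h3 : (f z - w₀) * exp (-L z) = (f c - w₀) * exp (-L c) := sub_eq_zero.1 this
    rw [sub_eq_add_neg (L z), exp_add]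
    calc f z - w₀ = ((f z - w₀) * exp (-L z)) * exp (L z) := by
          rw [mul_assoc, ← exp_add]; simp
      _ = _ := by rw [h3]; ring
  obtain ⟨w, hwball⟩ := exists_ball_subset_image hLd hr (by
    rw [← norm_pos_iff, hLc]; exact div_pos (norm_pos_iff.2 h0) (norm_pos_iff.2 (hne c hcm)))
  have hle : r * ‖deriv L c‖ / 96 ≤ Real.pi := by
    by_contra hlt
    push Not at hlt
    have hm : ∀ σ : ℝ, |σ| = 1 → w + σ * Real.pi * I ∈ ball w (r * ‖deriv L c‖ / 96) := by
      intro σ hσ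
      rw [mem_ball_iff_norm]
      simpa [hσ, abs_of_pos Real.pi_pos] using hlt
    obtain ⟨z₁, hz₁, e₁⟩ := hwball (hm 1 (by simp))
    obtain ⟨z₂, hz₂, e₂⟩ := hwball (hm (-1) (by simp))
    have : f z₁ = f z₂ := by
      have h1 := hconst z₁ hz₁
      have h2 := hconst z₂ hz₂
      have h3 : exp (L z₁ - L c) = exp (L z₂ - L c) := by
        rw [e₁, e₂]
        have : w + ((1 : ℝ) : ℂ) * Real.pi * I - L c =
          (w + ((-1 : ℝ) : ℂ) * Real.pi * I - L c) + 2 * Real.pi * I := by push_cast; ring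
        rw [this, exp_periodic]
      rw [h3, ← h2] at h1
      exact sub_left_injective h1
    have h4 := hinj hz₁ hz₂ this
    rw [h4, e₂] at e₁
    have h5 := congrArg im e₁
    simp at h5
    linarith [Real.pi_pos]
  rw [hLc] at hle
  have hpos := norm_pos_iff.2 (hne c hcm)
  have h4 := Real.pi_le_four
  have h6 : r * (‖deriv f c‖ / ‖f c - w₀‖) ≤ 384 := by linarith
  rw [← mul_div_assoc, div_le_iff₀ hpos] at h6
  exact h6

-- With q = f'/(f - w₀), one has f'' = q'(f - w₀) + qf'. The Koebe bound on discs of radius r/2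
-- controls q, and Cauchy's estimate then controls q'. The hypothesis on B turns the factor f(c) -
-- w₀ into a multiple of rf'(c).
open Metric Complex in
theorem mul_norm_deriv_deriv_le_of_notMem_image {f : ℂ → ℂ} {c w₀ : ℂ} {r B : ℝ}
    (hf : DifferentiableOn ℂ f (ball c r)) (hinj : InjOn f (ball c r)) (hr : 0 < r)
    (hw : w₀ ∉ f '' ball c r) (hB : ‖f c - w₀‖ ≤ B * (r * ‖deriv f c‖)) :
    r * ‖deriv (deriv f) c‖ ≤ (3072 * B + 768) * ‖deriv f c‖ := by
  have hne : ∀ z ∈ ball c r, f z - w₀ ≠ 0 := fun z hz h => hw ⟨z, hz, sub_eq_zero.1 h⟩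
  have hf' : DifferentiableOn ℂ (deriv f) (ball c r) := hf.deriv isOpen_ball
  have hcm : c ∈ ball c r := mem_ball_self hr
  set q : ℂ → ℂ := fun z => deriv f z / (f z - w₀) with hq
  have hqd : DifferentiableOn ℂ q (ball c r) := DifferentiableOn.div hf' (hf.sub_const w₀) hne
  have hqb : ∀ z ∈ closedBall c (r / 2), ‖q z‖ ≤ 768 / r := by
    intro z hz
    have hzr : z ∈ ball c r := closedBall_subset_ball (by linarith) hz
    have hsub : ball z (r / 2) ⊆ ball c r := ball_subset_ball' (by
      rw [mem_closedBall] at hz; linarith)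
    have := mul_norm_deriv_le_of_notMem_image (hf.mono hsub) (hinj.mono hsub) (by positivity)
      (fun h => hw (image_mono hsub h))
    rw [hq, norm_div, div_le_div_iff₀ (norm_pos_iff.2 (hne z hzr)) hr]
    linarith
  have hq' : ‖deriv q c‖ ≤ 768 / r / (r / 2) := by
    apply norm_deriv_le_of_forall_mem_sphere_norm_le (by positivity)
    · exact (hqd.mono (closedBall_subset_ball (by linarith))).diffContOnCl_ball subset_rfl
    · exact fun z hz => hqb z (sphere_subset_closedBall hz)
  have h2 : deriv (deriv f) c = deriv q c * (f c - w₀) + q c * deriv f c := by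
    have h1 := (hf.differentiableAt (isOpen_ball.mem_nhds hcm)).hasDerivAt.sub_const w₀
    have h3 := (hqd.differentiableAt (isOpen_ball.mem_nhds hcm)).hasDerivAt.mul h1
    rw [← h3.deriv]
    apply Filter.EventuallyEq.deriv_eq
    filter_upwards [isOpen_ball.mem_nhds hcm] with z hz
    simp only [hq, Pi.mul_apply]
    rw [div_mul_cancel₀ _ (hne z hz)]
  have hqc := hqb c (mem_closedBall_self (by positivity))
  rw [h2]
  calc r * ‖deriv q c * (f c - w₀) + q c * deriv f c‖
      ≤ r * (‖deriv q c‖ * ‖f c - w₀‖ + ‖q c‖ * ‖deriv f c‖) := by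
        gcongr
        exact (norm_add_le _ _).trans (by rw [norm_mul, norm_mul])
    _ ≤ r * (768 / r / (r / 2) * (B * (r * ‖deriv f c‖)) + 768 / r * ‖deriv f c‖) := by
        gcongr
    _ = (1536 * B + 768) * ‖deriv f c‖ := by field_simp; ring
    _ ≤ _ := by
        have : 0 ≤ B * (r * ‖deriv f c‖) := (norm_nonneg _).trans hB
        rw [← mul_assoc, mul_comm B r, mul_assoc] at this
        have := nonneg_of_mul_nonneg_right this hr
        nlinarith

end HolderTract

/-! ### Distortion of the Riemann map of a tract -/

namespace HolderTract

theorem isOpen_rightHalfPlane : IsOpen rightHalfPlane :=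
  isOpen_lt continuous_const Complex.continuous_re

theorem ball_subset_rightHalfPlane {z : ℂ} {r : ℝ} (hr : r ≤ z.re) :
    Metric.ball z r ⊆ rightHalfPlane := by
  intro w hw
  rw [mem_ball_iff_norm] at hw
  have h := (abs_le.1 (Complex.abs_re_le_norm (w - z))).1
  rw [Complex.sub_re] at h
  change 0 < w.re
  linarith

namespace IsTractModel

variable {Ω : Set ℂ} {τ φ : ℂ → ℂ}

theorem injOn (h : IsTractModel Ω τ φ) : InjOn φ rightHalfPlane := by
  intro x hx y hy hxy
  rw [← h.right_inv x hx, ← h.right_inv y hy, hxy]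

theorem hasDerivAt (h : IsTractModel Ω τ φ) {z : ℂ} (hz : z ∈ rightHalfPlane) :
    HasDerivAt φ (deriv φ z) z :=
  (h.holo_inv.differentiableAt (isOpen_rightHalfPlane.mem_nhds hz)).hasDerivAt

theorem hasDerivAt_tau (h : IsTractModel Ω τ φ) {z : ℂ} (hz : z ∈ Ω) :
    HasDerivAt τ (deriv τ z) z :=
  (h.holo.differentiableAt (h.isOpen.mem_nhds hz)).hasDerivAt

theorem differentiableOn_deriv (h : IsTractModel Ω τ φ) :
    DifferentiableOn ℂ (deriv φ) rightHalfPlane :=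
  h.holo_inv.deriv isOpen_rightHalfPlane

theorem deriv_tau_mul_deriv (h : IsTractModel Ω τ φ) {z : ℂ} (hz : z ∈ rightHalfPlane) :
    deriv τ (φ z) * deriv φ z = 1 := by
  have h1 := (h.hasDerivAt_tau (h.mapsTo_inv hz)).comp z (h.hasDerivAt hz)
  have h2 : HasDerivAt (τ ∘ φ) 1 z := by
    apply (hasDerivAt_id z).congr_of_eventuallyEq
    filter_upwards [isOpen_rightHalfPlane.mem_nhds hz] with w hw using h.right_inv w hw
  exact h1.unique h2

theorem deriv_ne_zero (h : IsTractModel Ω τ φ) {z : ℂ} (hz : z ∈ rightHalfPlane) :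
    deriv φ z ≠ 0 := right_ne_zero_of_mul_eq_one (h.deriv_tau_mul_deriv hz)

theorem norm_deriv_pos (h : IsTractModel Ω τ φ) {z : ℂ} (hz : z ∈ rightHalfPlane) :
    0 < ‖deriv φ z‖ := norm_pos_iff.2 (h.deriv_ne_zero hz)

open Metric in
/-- The distance of `φ z` to the complement of the tract, bounded by the Schwarz lemma for `τ`. -/
theorem le_of_ball_subset (h : IsTractModel Ω τ φ) {z : ℂ} (hz : z ∈ rightHalfPlane) {ρ : ℝ}
    (hρ : 0 < ρ) (hsub : ball (φ z) ρ ⊆ Ω) : ρ ≤ 2 * z.re * ‖deriv φ z‖ := by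
  have hz' : 0 < z.re := hz
  -- τ followed by the Möbius map of the half-plane to the disc sending z to 0. Its derivative at
  -- φ(z) has modulus 1/(2 Re z |φ'(z)|).
  set v : ℂ → ℂ := fun w => (τ w - z) / (τ w + (starRingEnd ℂ) z) with hv
  have hden : ∀ w ∈ Ω, τ w + (starRingEnd ℂ) z ≠ 0 := by
    intro w hw h0
    have h1 : 0 < (τ w).re := h.mapsTo hw
    have := congrArg Complex.re h0
    simp at this
    linarith
  have hvd : ∀ w ∈ Ω, HasDerivAt v ((deriv τ w * (τ w + (starRingEnd ℂ) z) -
      (τ w - z) * deriv τ w) / (τ w + (starRingEnd ℂ) z) ^ 2) w := fun w hw =>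
    ((h.hasDerivAt_tau hw).sub_const z).div ((h.hasDerivAt_tau hw).add_const _) (hden w hw)
  have hv0 : v (φ z) = 0 := by simp [hv, h.right_inv z hz]
  have hmaps : MapsTo v (ball (φ z) ρ) (closedBall (v (φ z)) 1) := by
    intro w hw
    rw [hv0, mem_closedBall_zero_iff, hv, norm_div, div_le_one (norm_pos_iff.2 (hden w (hsub hw)))]
    have h1 : 0 < (τ w).re := h.mapsTo (hsub hw)
    rw [← sq_le_sq₀ (norm_nonneg _) (norm_nonneg _), Complex.sq_norm, Complex.sq_norm,
      Complex.normSq_apply, Complex.normSq_apply]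
    simp
    nlinarith [mul_pos h1 hz']
  have := Complex.norm_deriv_le_div_of_mapsTo_ball
    (fun w hw => (hvd w (hsub hw)).differentiableAt.differentiableWithinAt) hmaps hρ
  rw [(hvd _ (h.mapsTo_inv hz)).deriv, h.right_inv z hz] at this
  have e1 : z + (starRingEnd ℂ) z = ((2 * z.re : ℝ) : ℂ) := Complex.add_conj z
  have hτ := h.deriv_tau_mul_deriv hz
  have hτn := congrArg norm hτ
  rw [norm_mul, norm_one] at hτn
  rw [e1, sub_self, zero_mul, sub_zero, norm_div, norm_mul, norm_pow, Complex.norm_real,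
    Real.norm_eq_abs, abs_of_pos (by positivity)] at this
  have hp := h.norm_deriv_pos hz
  have e2 : ‖deriv τ (φ z)‖ = ‖deriv φ z‖⁻¹ := eq_inv_of_mul_eq_one_left hτn
  rw [e2, le_div_iff₀ hρ] at this
  have e3 : ‖deriv φ z‖⁻¹ * (2 * z.re) / (2 * z.re) ^ 2 * ρ = ρ / (2 * z.re * ‖deriv φ z‖) := by
    field_simp
  rw [e3, div_le_one (by positivity)] at this
  exact this

theorem exists_notMem (h : IsTractModel Ω τ φ) {z : ℂ} (hz : z ∈ rightHalfPlane) :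
    ∃ w, w ∉ Ω ∧ ‖φ z - w‖ ≤ 3 * (z.re * ‖deriv φ z‖) := by
  have hz' : 0 < z.re := hz
  have hp := h.norm_deriv_pos hz
  by_contra hcon
  push Not at hcon
  have := h.le_of_ball_subset hz (ρ := 3 * (z.re * ‖deriv φ z‖)) (by positivity) (by
    intro w hw
    by_contra hw'
    have := hcon w hw'
    rw [mem_ball_iff_norm'] at hw
    linarith)
  nlinarith [mul_pos hz' hp]

/-- φ is injective on B(z, Re z) and omits a point at distance at most 3 Re z |φ'(z)| from φ(z).
With B = 3 the constant is 3072 · 3 + 768 = 9984, rounded up to 10000. This differential inequality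
is the source of all distortion estimates below. -/
theorem mul_norm_deriv_deriv_le (h : IsTractModel Ω τ φ) {z : ℂ} (hz : z ∈ rightHalfPlane) :
    ‖deriv (deriv φ) z‖ ≤ 10000 / z.re * ‖deriv φ z‖ := by
  have hz' : 0 < z.re := hz
  obtain ⟨w, hw, hwz⟩ := h.exists_notMem hz
  have hsub := ball_subset_rightHalfPlane (le_refl z.re)
  have := mul_norm_deriv_deriv_le_of_notMem_image (h.holo_inv.mono hsub) (h.injOn.mono hsub) hz'
    (fun ⟨x, hx, hxw⟩ => hw (hxw ▸ h.mapsTo_inv (hsub hx))) hwz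
  rw [div_mul_eq_mul_div, le_div_iff₀ hz']
  nlinarith [h.norm_deriv_pos hz]

/-- Koebe on the disc centred at z with w on its boundary: by injectivity φ(w) is omitted there.
This is what bounds the contraction of the inverse branches from below. -/
theorem mul_norm_deriv_mul_norm_sub_le (h : IsTractModel Ω τ φ) {z w : ℂ}
    (hw : w ∈ rightHalfPlane) (hzw : ‖z - w‖ ≤ z.re) :
    ‖deriv φ z‖ * ‖z - w‖ ≤ 384 * ‖φ z - φ w‖ := by
  rcases (norm_nonneg (z - w)).eq_or_lt with h0 | h0
  · rw [← h0, mul_zero]; positivity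
  have hsub := ball_subset_rightHalfPlane hzw
  rw [mul_comm]
  apply mul_norm_deriv_le_of_notMem_image (h.holo_inv.mono hsub) (h.injOn.mono hsub) h0
  rintro ⟨x, hx, hxw⟩
  rw [h.injOn (hsub hx) hw hxw, mem_ball_iff_norm', lt_self_iff_false] at hx
  exact hx

/-- Distortion of `φ` along a path of bounded hyperbolic speed. -/
theorem norm_deriv_le_of_path (h : IsTractModel Ω τ φ) {γ γ' : ℝ → ℂ} {N : ℝ}
    (hγ : ∀ s, HasDerivAt γ (γ' s) s) (hm : ∀ s ∈ Icc (0 : ℝ) 1, γ s ∈ rightHalfPlane)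
    (hN : ∀ s ∈ Icc (0 : ℝ) 1, ‖γ' s‖ ≤ N * (γ s).re) :
    ‖deriv φ (γ 1)‖ ≤ ‖deriv φ (γ 0)‖ * Real.exp (10000 * N) := by
  have hd : ∀ s ∈ Icc (0 : ℝ) 1,
      HasDerivAt (fun s => deriv φ (γ s)) (deriv (deriv φ) (γ s) * γ' s) s := by
    intro s hs
    have h1 := (h.differentiableOn_deriv.differentiableAt
      (isOpen_rightHalfPlane.mem_nhds (hm s hs))).hasDerivAt
    exact h1.comp s (hγ s)
  have := norm_le_gronwallBound_of_norm_deriv_right_le (f := fun s => deriv φ (γ s))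
    (δ := ‖deriv φ (γ 0)‖) (K := 10000 * N) (ε := 0) (a := 0) (b := 1)
    (fun s hs => (hd s hs).continuousAt.continuousWithinAt)
    (fun s hs => (hd s (Ico_subset_Icc_self hs)).hasDerivWithinAt) le_rfl (by
      intro s hs
      have hs' := Ico_subset_Icc_self hs
      have hre : 0 < (γ s).re := hm s hs'
      have h1 := h.mul_norm_deriv_deriv_le (hm s hs')
      rw [norm_mul, add_zero]
      calc _ ≤ 10000 / (γ s).re * ‖deriv φ (γ s)‖ * (N * (γ s).re) := by
            gcongr
            exact hN s hs'
        _ = _ := by field_simp) 1 (by simp)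
  simpa [gronwallBound_ε0] using this

theorem norm_deriv_le_vertical (h : IsTractModel Ω τ φ) {z w : ℂ} (hz : z ∈ rightHalfPlane)
    (hzw : w.re = z.re) :
    ‖deriv φ w‖ ≤ ‖deriv φ z‖ * Real.exp (10000 * (|w.im - z.im| / z.re)) := by
  have hz' : 0 < z.re := hz
  have hre : ∀ s : ℝ, (z + (s : ℂ) * (w - z)).re = z.re := by intro s; simp [hzw]
  have h1 := h.norm_deriv_le_of_path (γ := fun s : ℝ => z + (s : ℂ) * (w - z))
    (γ' := fun _ => w - z) (N := |w.im - z.im| / z.re) (by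
      intro s
      have := ((Complex.ofRealCLM.hasDerivAt (x := s)).mul_const (w - z)).const_add z
      simpa using this) (by
      intro s _
      change 0 < (z + (s : ℂ) * (w - z)).re
      rwa [hre]) (by
      intro s _
      rw [hre, div_mul_cancel₀ _ hz'.ne']
      have e : w - z = ((w.im - z.im : ℝ) : ℂ) * Complex.I := by
        apply Complex.ext <;> simp [hzw]
      rw [e, norm_mul, Complex.norm_I, mul_one, Complex.norm_real, Real.norm_eq_abs])
  simpa using h1

theorem norm_deriv_le_horizontal (h : IsTractModel Ω τ φ) {z w : ℂ} (hz : z ∈ rightHalfPlane)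
    (hw : w ∈ rightHalfPlane) (hzw : w.im = z.im) :
    ‖deriv φ w‖ ≤ ‖deriv φ z‖ * Real.exp (10000 * |Real.log (w.re / z.re)|) := by
  have hz' : 0 < z.re := hz
  have hw' : 0 < w.re := hw
  set a := Real.log (w.re / z.re) with ha
  -- The exponential parametrisation has constant hyperbolic speed |a|, so the loss is a power of
  -- the ratio of real parts.
  set γ : ℝ → ℂ := fun s => ((z.re * Real.exp (s * a) : ℝ) : ℂ) + z.im * Complex.I with hγ
  have hre : ∀ s : ℝ, (γ s).re = z.re * Real.exp (s * a) := by intro s; simp [hγ, -Complex.ofReal_exp, -Complex.ofReal_mul]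
  have h1 := h.norm_deriv_le_of_path (γ := γ)
    (γ' := fun s => ((z.re * (Real.exp (s * a) * a) : ℝ) : ℂ)) (N := |a|) (by
      intro s
      have h2 : HasDerivAt (fun s => z.re * Real.exp (s * a)) (z.re * (Real.exp (s * a) * a)) s := by
        have := (((hasDerivAt_id s).mul_const a).exp.const_mul z.re)
        simpa using this
      exact h2.ofReal_comp.add_const _) (by
      intro s _
      change 0 < (γ s).re
      rw [hre]; positivity) (by
      intro s _
      rw [hre, Complex.norm_real, Real.norm_eq_abs, abs_mul, abs_mul, abs_of_pos hz',
        abs_of_pos (Real.exp_pos _)]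
      exact le_of_eq (by ring))
  have e1 : γ 1 = w := by
    apply Complex.ext
    · rw [hre, one_mul, ha, Real.exp_log (by positivity)]; field_simp
    · simp [hγ, hzw, -Complex.ofReal_exp, -Complex.ofReal_mul]
  have e0 : γ 0 = z := by
    apply Complex.ext
    · rw [hre]; simp
    · simp [hγ]
  rwa [e0, e1] at h1

/-- The path goes horizontally first and then vertically along the line through w, which is why the
vertical term is divided by the real part of w. -/
theorem norm_deriv_le (h : IsTractModel Ω τ φ) {z w : ℂ} (hz : z ∈ rightHalfPlane)
    (hw : w ∈ rightHalfPlane) : ‖deriv φ w‖ ≤ ‖deriv φ z‖ *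
      Real.exp (10000 * (|Real.log (w.re / z.re)| + |w.im - z.im| / w.re)) := by
  have hv : (⟨w.re, z.im⟩ : ℂ) ∈ rightHalfPlane := hw
  have h1 := h.norm_deriv_le_horizontal hz hv rfl
  have h2 := h.norm_deriv_le_vertical hv (w := w) rfl
  calc _ ≤ _ := h2
    _ ≤ ‖deriv φ z‖ * Real.exp (10000 * |Real.log (w.re / z.re)|) *
      Real.exp (10000 * (|w.im - z.im| / w.re)) := by gcongr
    _ = _ := by rw [mul_assoc, ← Real.exp_add]; ring_nf

end IsTractModel
end HolderTract

/-! ### Limit sets of finite systems of inverse branches -/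

namespace HolderTract

/-- A finite system of inverse branches `ψ i`, `i ∈ S`, of `f` on the disk `B(c, r)`, with pairwise
disjoint images in a smaller disk. -/
structure IsBranchSystem (f : ℂ → ℂ) (Ω : Set ℂ) (S : Finset ℤ) (ψ : ℤ → ℂ → ℂ) (c : ℂ)
    (r r' : ℝ) : Prop where
  lt : r' < r
  isOpen : IsOpen Ω
  holo : DifferentiableOn ℂ f Ω
  nonempty : S.Nonempty
  mapsTo : ∀ i ∈ S, MapsTo (ψ i) (Metric.ball c r) (Metric.closedBall c r')
  mapsTo_dom : ∀ i ∈ S, MapsTo (ψ i) (Metric.ball c r) Ω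
  holo_branch : ∀ i ∈ S, DifferentiableOn ℂ (ψ i) (Metric.ball c r)
  inv : ∀ i ∈ S, ∀ w ∈ Metric.ball c r, f (ψ i w) = w
  ne : ∀ i ∈ S, ∀ j ∈ S, i ≠ j → ∀ w ∈ Metric.ball c r, ψ i w ≠ ψ j w
  contr : ∀ i ∈ S, ∀ w ∈ Metric.ball c r, ‖deriv (ψ i) w‖ ≤ 1 / 2
  center_mem : c ∈ Metric.ball c r

/-- The invariant set of a system of inverse branches. -/
def branchLimitSet (f : ℂ → ℂ) (S : Finset ℤ) (ψ : ℤ → ℂ → ℂ) (c : ℂ) (r : ℝ) : Set ℂ :=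
  {z | ∀ n : ℕ, ∃ i ∈ S, f^[n] z ∈ ψ i '' Metric.ball c r}

namespace IsBranchSystem

open Metric

variable {f : ℂ → ℂ} {Ω : Set ℂ} {S : Finset ℤ} {ψ : ℤ → ℂ → ℂ} {c : ℂ} {r r' : ℝ}

theorem apply_mem (_h : IsBranchSystem f Ω S ψ c r r') {z : ℂ}
    (hz : z ∈ branchLimitSet f S ψ c r) : f z ∈ branchLimitSet f S ψ c r := by
  intro n
  have := hz (n + 1)
  rwa [Function.iterate_succ_apply] at this

theorem mem_closedBall (h : IsBranchSystem f Ω S ψ c r r') {z : ℂ}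
    (hz : z ∈ branchLimitSet f S ψ c r) : z ∈ closedBall c r' := by
  obtain ⟨i, hi, w, hw, e⟩ := hz 0
  rw [Function.iterate_zero, id] at e
  exact e ▸ h.mapsTo i hi hw

theorem mem_ball (h : IsBranchSystem f Ω S ψ c r r') {z : ℂ}
    (hz : z ∈ branchLimitSet f S ψ c r) : z ∈ ball c r :=
  closedBall_subset_ball h.lt (h.mem_closedBall hz)

theorem exists_code (h : IsBranchSystem f Ω S ψ c r r') {z : ℂ}
    (hz : z ∈ branchLimitSet f S ψ c r) : ∃ i ∈ S, ψ i (f z) = z := by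
  obtain ⟨i, hi, w, hw, e⟩ := hz 0
  rw [Function.iterate_zero, id] at e
  refine ⟨i, hi, ?_⟩
  rw [← e, h.inv i hi w hw]

theorem branch_mem (h : IsBranchSystem f Ω S ψ c r r') {z : ℂ}
    (hz : z ∈ branchLimitSet f S ψ c r) {i : ℤ} (hi : i ∈ S) :
    ψ i z ∈ branchLimitSet f S ψ c r := by
  intro n
  cases n with
  | zero => exact ⟨i, hi, z, h.mem_ball hz, rfl⟩
  | succ n =>
    rw [Function.iterate_succ_apply, h.inv i hi z (h.mem_ball hz)]
    exact hz n

theorem mem_dom (h : IsBranchSystem f Ω S ψ c r r') {z : ℂ}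
    (hz : z ∈ branchLimitSet f S ψ c r) : z ∈ Ω := by
  obtain ⟨i, hi, e⟩ := h.exists_code hz
  exact e ▸ h.mapsTo_dom i hi (h.mem_ball (h.apply_mem hz))

theorem hasDerivAt_branch (h : IsBranchSystem f Ω S ψ c r r') {i : ℤ} (hi : i ∈ S) {w : ℂ}
    (hw : w ∈ ball c r) : HasDerivAt (ψ i) (deriv (ψ i) w) w :=
  ((h.holo_branch i hi).differentiableAt (isOpen_ball.mem_nhds hw)).hasDerivAt

theorem deriv_mul_deriv (h : IsBranchSystem f Ω S ψ c r r') {i : ℤ} (hi : i ∈ S) {w : ℂ}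
    (hw : w ∈ ball c r) : deriv f (ψ i w) * deriv (ψ i) w = 1 := by
  have h1 := (h.holo.differentiableAt (h.isOpen.mem_nhds (h.mapsTo_dom i hi hw))).hasDerivAt.comp w
    (h.hasDerivAt_branch hi hw)
  have h2 : HasDerivAt (f ∘ ψ i) 1 w := by
    apply (hasDerivAt_id w).congr_of_eventuallyEq
    filter_upwards [isOpen_ball.mem_nhds hw] with v hv using h.inv i hi v hv
  exact h1.unique h2

theorem norm_branch_sub_le (h : IsBranchSystem f Ω S ψ c r r') {i : ℤ} (hi : i ∈ S) {x y : ℂ}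
    (hx : x ∈ ball c r) (hy : y ∈ ball c r) : ‖ψ i x - ψ i y‖ ≤ 1 / 2 * ‖x - y‖ :=
  (convex_ball c r).norm_image_sub_le_of_norm_hasDerivWithin_le
    (fun _ hw => (h.hasDerivAt_branch hi hw).hasDerivWithinAt) (h.contr i hi) hy hx

theorem nonempty_limitSet (h : IsBranchSystem f Ω S ψ c r r') :
    (branchLimitSet f S ψ c r).Nonempty := by
  obtain ⟨i, hi⟩ := h.nonempty
  have hsub := closedBall_subset_ball (x := c) h.lt
  -- The fixed point of a single contracting branch is also a fixed point of f, so its whole orbit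
  -- lies in the image of that branch.
  have hm : MapsTo (ψ i) (closedBall c r') (closedBall c r') := (h.mapsTo i hi).mono_left hsub
  have hc : ContractingWith (1 / 2) (hm.restrict (ψ i) _ _) := by
    refine ⟨by norm_num, LipschitzWith.of_dist_le_mul fun x y => ?_⟩
    have := h.norm_branch_sub_le hi (hsub x.2) (hsub y.2)
    simpa [Subtype.dist_eq, dist_eq_norm] using this
  obtain ⟨y, hy, hfix, -⟩ := hc.exists_fixedPoint' isClosed_closedBall.isComplete hm
    (h.mapsTo i hi h.center_mem) (edist_ne_top _ _)
  refine ⟨y, fun n => ⟨i, hi, ?_⟩⟩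
  have hy' := hsub hy
  have hf : Function.IsFixedPt f y := by
    have := h.inv i hi y hy'
    rwa [hfix.eq] at this
  rw [(hf.iterate n).eq]
  exact ⟨y, hy', hfix⟩

theorem isCompact_image (h : IsBranchSystem f Ω S ψ c r r') {i : ℤ} (hi : i ∈ S) :
    IsCompact (ψ i '' closedBall c r') :=
  (isCompact_closedBall c r').image_of_continuousOn
    ((h.holo_branch i hi).continuousOn.mono (closedBall_subset_ball h.lt))

theorem mem_iUnion_image (h : IsBranchSystem f Ω S ψ c r r') {z : ℂ}
    (hz : z ∈ branchLimitSet f S ψ c r) : z ∈ ⋃ i ∈ S, ψ i '' closedBall c r' := by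
  obtain ⟨i, hi, e⟩ := h.exists_code hz
  exact mem_biUnion hi ⟨f z, h.mem_closedBall (h.apply_mem hz), e⟩

/-- The defining condition uses images of open discs, but a point of the limit set is ψ_i of another
such point, hence lies in the compact union of the sets ψ_i(closed disc of radius r'). That union
absorbs limits, and continuity of f carries the closure into itself. -/
theorem isCompact_limitSet (h : IsBranchSystem f Ω S ψ c r r') :
    IsCompact (branchLimitSet f S ψ c r) := by
  have hK : IsCompact (⋃ i ∈ S, ψ i '' closedBall c r') :=
    S.isCompact_biUnion fun i hi => h.isCompact_image hi
  refine hK.of_isClosed_subset ?_ fun z hz => h.mem_iUnion_image hz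
  have hcl : closure (branchLimitSet f S ψ c r) ⊆ ⋃ i ∈ S, ψ i '' closedBall c r' :=
    closure_minimal (fun z hz => h.mem_iUnion_image hz) hK.isClosed
  have hstep : ∀ z ∈ closure (branchLimitSet f S ψ c r),
      f z ∈ closure (branchLimitSet f S ψ c r) := by
    intro z hz
    obtain ⟨i, hi, w, hw, e⟩ := mem_iUnion₂.1 (hcl hz)
    have hzΩ : z ∈ Ω := e ▸ h.mapsTo_dom i hi (closedBall_subset_ball h.lt hw)
    have hc : ContinuousAt f z := (h.holo.differentiableAt (h.isOpen.mem_nhds hzΩ)).continuousAt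
    exact closure_mono (by rintro _ ⟨x, hx, rfl⟩; exact h.apply_mem hx)
      (hc.continuousWithinAt.mem_closure_image hz)
  refine isClosed_of_closure_subset fun z hz n => ?_
  have hn : f^[n] z ∈ closure (branchLimitSet f S ψ c r) := by
    induction n with
    | zero => exact hz
    | succ n ih => rw [Function.iterate_succ_apply']; exact hstep _ ih
  obtain ⟨i, hi, w, hw, e⟩ := mem_iUnion₂.1 (hcl hn)
  exact ⟨i, hi, w, closedBall_subset_ball h.lt hw, e⟩

theorem two_pow_le (h : IsBranchSystem f Ω S ψ c r r') (n : ℕ) {z : ℂ}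
    (hz : z ∈ branchLimitSet f S ψ c r) : ∃ d, HasDerivAt f^[n] d z ∧ 2 ^ n ≤ ‖d‖ := by
  induction n generalizing z with
  | zero => exact ⟨1, hasDerivAt_id z, by simp⟩
  | succ n ih =>
    obtain ⟨d, hd, hdn⟩ := ih (h.apply_mem hz)
    have hf := (h.holo.differentiableAt (h.isOpen.mem_nhds (h.mem_dom hz))).hasDerivAt
    refine ⟨_, hd.comp z hf, ?_⟩
    obtain ⟨i, hi, e⟩ := h.exists_code hz
    have hfz := h.mem_ball (h.apply_mem hz)
    have h1 := congrArg norm (h.deriv_mul_deriv hi hfz)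
    rw [e, norm_mul, norm_one] at h1
    have h2 := h.contr i hi _ hfz
    have h3 : 2 ≤ ‖deriv f z‖ := by nlinarith [norm_nonneg (deriv f z)]
    rw [norm_mul, pow_succ]
    gcongr

theorem isExpandingRepeller (h : IsBranchSystem f Ω S ψ c r r') :
    IsExpandingRepeller f Ω (branchLimitSet f S ψ c r) where
  isCompact := h.isCompact_limitSet
  nonempty := h.nonempty_limitSet
  image_eq := by
    refine Subset.antisymm (image_subset_iff.2 fun x hx => h.apply_mem hx) fun z hz => ?_
    obtain ⟨i, hi⟩ := h.nonempty
    exact ⟨ψ i z, h.branch_mem hz hi, h.inv i hi z (h.mem_ball hz)⟩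
  expanding := by
    refine ⟨1, 2, one_pos, one_lt_two, fun n z hz => ?_⟩
    obtain ⟨d, hd, hn⟩ := h.two_pow_le n hz
    rwa [hd.deriv, one_mul]
  isolated := by
    -- For this neighbourhood isolation is the very definition of the limit set. It is open because
    -- the branches have nonvanishing derivative.
    refine ⟨⋃ i ∈ S, ψ i '' ball c r, ?_, ?_, ?_, ?_⟩
    · refine isOpen_biUnion fun i hi => isOpen_iff_mem_nhds.2 ?_
      rintro _ ⟨w, hw, rfl⟩
      have han := ((h.holo_branch i hi).analyticAt (isOpen_ball.mem_nhds hw))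
      rw [← han.hasStrictDerivAt.map_nhds_eq
        (right_ne_zero_of_mul_eq_one (h.deriv_mul_deriv hi hw))]
      exact image_mem_map (isOpen_ball.mem_nhds hw)
    · intro z hz
      obtain ⟨i, hi, hz0⟩ := hz 0
      exact mem_biUnion hi hz0
    · exact iUnion₂_subset fun i hi => (h.mapsTo_dom i hi).image_subset
    · intro z hz n
      simpa using hz n

/-- If ψ_i(x) = ψ_j(y), applying f gives x = y, so distinct branches have disjoint images even at
different points; compactness makes the gap uniform. -/
theorem exists_separation (h : IsBranchSystem f Ω S ψ c r r') :
    ∃ d > 0, ∀ i ∈ S, ∀ j ∈ S, i ≠ j → ∀ x ∈ closedBall c r', ∀ y ∈ closedBall c r',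
      d ≤ ‖ψ i x - ψ j y‖ := by
  have hK : IsCompact (⋃ i ∈ S, ⋃ j ∈ S.erase i,
      (ψ i '' closedBall c r') ×ˢ (ψ j '' closedBall c r')) :=
    S.isCompact_biUnion fun i hi => (S.erase i).isCompact_biUnion fun j hj =>
      (h.isCompact_image hi).prod (h.isCompact_image (Finset.mem_of_mem_erase hj))
  set K := ⋃ i ∈ S, ⋃ j ∈ S.erase i, (ψ i '' closedBall c r') ×ˢ (ψ j '' closedBall c r') with hKd
  have hmem : ∀ i ∈ S, ∀ j ∈ S, i ≠ j → ∀ x ∈ closedBall c r', ∀ y ∈ closedBall c r',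
      (ψ i x, ψ j y) ∈ K := fun i hi j hj hij x hx y hy =>
    mem_biUnion hi (mem_biUnion (Finset.mem_erase.2 ⟨hij.symm, hj⟩)
      ⟨mem_image_of_mem _ hx, mem_image_of_mem _ hy⟩)
  rcases K.eq_empty_or_nonempty with h0 | h0
  · refine ⟨1, one_pos, fun i hi j hj hij x hx y hy => ?_⟩
    have := hmem i hi j hj hij x hx y hy
    rw [h0] at this
    exact this.elim
  · obtain ⟨p, hp, hmin⟩ := hK.exists_isMinOn h0
      (f := fun p : ℂ × ℂ => ‖p.1 - p.2‖) (by fun_prop)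
    refine ⟨‖p.1 - p.2‖, ?_, fun i hi j hj hij x hx y hy => hmin (hmem i hi j hj hij x hx y hy)⟩
    obtain ⟨i, hi, hp⟩ := mem_iUnion₂.1 hp
    obtain ⟨j, hj, ⟨x, hx, e₁⟩, ⟨y, hy, e₂⟩⟩ := mem_iUnion₂.1 hp
    rw [gt_iff_lt, norm_pos_iff, sub_ne_zero, ← e₁, ← e₂]
    intro e
    have hj' := Finset.mem_erase.1 hj
    have hx' := closedBall_subset_ball h.lt hx
    have hy' := closedBall_subset_ball h.lt hy
    have e' := congrArg f e
    rw [h.inv i hi x hx', h.inv j hj'.2 y hy'] at e'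
    rw [e'] at e
    exact h.ne i hi j hj'.2 hj'.1.symm y hy' e

end IsBranchSystem

/-! ### Dimension of the limit set through a devil's staircase -/

/-- The intervals `[∑_{j < k} p j, ∑_{j ≤ k} p j]` cover `[0, ∑ p j]`. -/
theorem exists_mem_partial_sum {S : Finset ℤ} {p : ℤ → ℝ} (hS : S.Nonempty) {y : ℝ} (hy : 0 ≤ y)
    (hy' : y ≤ ∑ j ∈ S, p j) :
    ∃ k ∈ S, ∑ j ∈ S with j < k, p j ≤ y ∧ y ≤ ∑ j ∈ S with j < k, p j + p k := by
  induction S using Finset.induction_on_max with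
  | empty => exact absurd hS (by simp)
  | insert a S ha ih =>
    have haS : a ∉ S := fun h => lt_irrefl _ (ha a h)
    have hfa : (insert a S).filter (· < a) = S := by
      ext j
      simp only [Finset.mem_filter, Finset.mem_insert]
      constructor
      · rintro ⟨rfl | h, h'⟩
        · exact absurd h' (lt_irrefl _)
        · exact h
      · exact fun h => ⟨Or.inr h, ha j h⟩
    by_cases hcase : S.Nonempty ∧ y ≤ ∑ j ∈ S, p j
    · obtain ⟨k, hk, h1⟩ := ih hcase.1 hcase.2
      have hfk : (insert a S).filter (· < k) = S.filter (· < k) := by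
        rw [Finset.filter_insert, if_neg (not_lt.2 (ha k hk).le)]
      exact ⟨k, Finset.mem_insert_of_mem hk, by rwa [hfk]⟩
    · refine ⟨a, Finset.mem_insert_self _ _, ?_, ?_⟩
      · rw [hfa]
        rcases S.eq_empty_or_nonempty with rfl | h0
        · simpa using hy
        · exact (not_le.1 fun h => hcase ⟨h0, h⟩).le
      · rw [hfa]
        rw [Finset.sum_insert haS] at hy'
        linarith

namespace IsBranchSystem

open Metric

variable {f : ℂ → ℂ} {Ω : Set ℂ} {S : Finset ℤ} {ψ : ℤ → ℂ → ℂ} {c : ℂ} {r r' : ℝ}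

open Classical in
/-- The code function: the limit of the distribution functions given by the weights `p`. -/
theorem exists_code_function (h : IsBranchSystem f Ω S ψ c r r') {p : ℤ → ℝ}
    (hp : ∀ i ∈ S, 0 < p i) (hsum : ∑ i ∈ S, p i = 1) :
    ∃ π : ℂ → ℝ, (∀ z, 0 ≤ π z ∧ π z ≤ 1) ∧ ∀ i ∈ S, ∀ z ∈ branchLimitSet f S ψ c r,
      π (ψ i z) = ∑ j ∈ S with j < i, p j + p i * π z := by
  obtain ⟨i₀, hi₀⟩ := h.nonempty
  -- k(z) is the first letter of the code of z; i₀ is a default where there is none.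
  set k : ℂ → ℤ := fun z => if H : ∃ i ∈ S, ψ i (f z) = z then H.choose else i₀ with hk
  have hkS : ∀ z, k z ∈ S := by
    intro z
    simp only [hk]
    split_ifs with H
    · exact H.choose_spec.1
    · exact hi₀
  have hkψ : ∀ i ∈ S, ∀ z ∈ branchLimitSet f S ψ c r, k (ψ i z) = i := by
    intro i hi z hz
    have hzb := h.mem_ball hz
    have hfz := h.inv i hi z hzb
    have H : ∃ j ∈ S, ψ j (f (ψ i z)) = ψ i z := ⟨i, hi, by rw [hfz]⟩
    simp only [hk]
    rw [dif_pos H]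
    have h1 := H.choose_spec
    by_contra hne
    exact h.ne _ h1.1 i hi hne z hzb ((congrArg _ hfz.symm).trans h1.2)
  set q : ℤ → ℝ := fun i => ∑ j ∈ S with j < i, p j with hq
  have hq0 : ∀ i, 0 ≤ q i := fun i =>
    Finset.sum_nonneg fun j hj => (hp j (Finset.mem_filter.1 hj).1).le
  have hqp : ∀ i ∈ S, q i + p i ≤ 1 := by
    intro i hi
    have hni : i ∉ S.filter (· < i) := by simp
    rw [hq, ← hsum, add_comm, ← Finset.sum_insert hni]
    refine Finset.sum_le_sum_of_subset_of_nonneg ?_ fun j hj _ => (hp j hj).le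
    exact Finset.insert_subset hi (Finset.filter_subset _ _)
  -- The iterates of T on the zero function increase and stay in [0, 1], so a pointwise limit exists
  -- and satisfies the self-similarity equation on the limit set.
  set T : (ℂ → ℝ) → ℂ → ℝ := fun P z => q (k z) + p (k z) * P (f z) with hT
  set P : ℕ → ℂ → ℝ := fun n => T^[n] 0 with hP
  have hPs : ∀ n z, P (n + 1) z = q (k z) + p (k z) * P n (f z) := by
    intro n z
    simp only [hP, Function.iterate_succ_apply', hT]
  have hb : ∀ n z, 0 ≤ P n z ∧ P n z ≤ 1 := by
    intro n
    induction n with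
    | zero => intro z; simp [hP]
    | succ n ih =>
      intro z
      rw [hPs]
      have hpk := hp _ (hkS z)
      refine ⟨add_nonneg (hq0 _) (mul_nonneg hpk.le (ih _).1), ?_⟩
      have := mul_le_mul_of_nonneg_left (ih (f z)).2 hpk.le
      linarith [hqp _ (hkS z)]
  have hmono : ∀ n z, P n z ≤ P (n + 1) z := by
    intro n
    induction n with
    | zero => intro z; simpa [hP] using (hb 1 z).1
    | succ n ih =>
      intro z
      rw [hPs, hPs]
      have := mul_le_mul_of_nonneg_left (ih (f z)) (hp _ (hkS z)).le
      linarith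
  have hbdd : ∀ z, BddAbove (range fun n => P n z) := fun z =>
    ⟨1, by rintro _ ⟨n, rfl⟩; exact (hb n z).2⟩
  have hlim : ∀ z, Tendsto (fun n => P n z) atTop (𝓝 (⨆ n, P n z)) := fun z =>
    tendsto_atTop_ciSup (monotone_nat_of_le_succ fun n => hmono n z) (hbdd z)
  refine ⟨fun z => ⨆ n, P n z, fun z => ⟨?_, ciSup_le fun n => (hb n z).2⟩, ?_⟩
  · exact (hb 0 z).1.trans (le_ciSup (hbdd z) 0)
  · intro i hi z hz
    have h1 := (hlim (ψ i z)).comp (tendsto_add_atTop_nat 1)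
    have h2 : Tendsto (fun n => q i + p i * P n z) atTop (𝓝 (q i + p i * ⨆ n, P n z)) :=
      ((hlim z).const_mul _).const_add _
    refine tendsto_nhds_unique h1 (h2.congr fun n => ?_)
    rw [Function.comp_apply, hPs, hkψ i hi z hz, h.inv i hi z (h.mem_ball hz)]

/-- Lower bound for the dimension of the limit set of a system of inverse branches. -/
theorem le_dimH (h : IsBranchSystem f Ω S ψ c r r') {s : ℤ → ℝ} {t : ℝ} (ht : 0 < t)
    (hs : ∀ i ∈ S, 0 < s i)
    (hlow : ∀ i ∈ S, ∀ x ∈ ball c r, ∀ y ∈ ball c r, s i * ‖x - y‖ ≤ ‖ψ i x - ψ i y‖)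
    (hsum : 1 ≤ ∑ i ∈ S, s i ^ t) : ENNReal.ofReal t ≤ dimH (branchLimitSet f S ψ c r) := by
  set X := branchLimitSet f S ψ c r with hX
  have hr : 0 < r := pos_of_mem_ball h.center_mem
  set σ := ∑ i ∈ S, s i ^ t with hσ
  have hσ0 : 0 < σ := one_pos.trans_le hsum
  -- Normalised weights. Since σ ≥ 1 they satisfy p_i ≤ s_i^t, which is what gives the staircase
  -- Hölder exponent t.
  set p : ℤ → ℝ := fun i => s i ^ t / σ with hp
  have hp0 : ∀ i ∈ S, 0 < p i := fun i hi => div_pos (Real.rpow_pos_of_pos (hs i hi) _) hσ0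
  have hpsum : ∑ i ∈ S, p i = 1 := by
    rw [hp, ← Finset.sum_div, div_self hσ0.ne']
  have hps : ∀ i ∈ S, p i ≤ s i ^ t := fun i hi =>
    div_le_self (Real.rpow_nonneg (hs i hi).le _) hsum
  set Λ : ℝ := (1 / 2) ^ t with hΛ
  have hΛ0 : 0 ≤ Λ := by positivity
  have hΛ1 : Λ < 1 := Real.rpow_lt_one (by norm_num) (by norm_num) ht
  have hpΛ : ∀ i ∈ S, p i ≤ Λ := by
    intro i hi
    refine (hps i hi).trans (Real.rpow_le_rpow (hs i hi).le ?_ ht.le)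
    have hm : c + (r / 2 : ℝ) ∈ ball c r := by
      rw [mem_ball_iff_norm, add_sub_cancel_left, Complex.norm_real, Real.norm_eq_abs,
        abs_of_pos (by positivity)]
      linarith
    have h1 := (hlow i hi _ hm c h.center_mem).trans (h.norm_branch_sub_le hi hm h.center_mem)
    rw [add_sub_cancel_left, Complex.norm_real, Real.norm_eq_abs, abs_of_pos (by positivity)] at h1
    exact le_of_mul_le_mul_right h1 (by positivity)
  obtain ⟨π, hπb, hπ⟩ := h.exists_code_function hp0 hpsum
  obtain ⟨d, hd0, hd⟩ := h.exists_separation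
  have habs : ∀ x y, |π x - π y| ≤ 1 := fun x y =>
    abs_le.2 ⟨by linarith [(hπb x).1, (hπb y).2], by linarith [(hπb x).2, (hπb y).1]⟩
  -- Two points in different pieces are at distance at least d, and the bound is trivial. In the
  -- same piece, passing to the f-images multiplies the difference of π by p_i and the distance to
  -- the power t by at least s_i^t. The error Λ^n allows induction without continuity of π.
  have hhol : ∀ n : ℕ, ∀ x ∈ X, ∀ y ∈ X,
      |π x - π y| ≤ (d ^ t)⁻¹ * ‖x - y‖ ^ t + Λ ^ n := by
    intro n
    induction n with
    | zero =>
      intro x _ y _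
      have : 0 ≤ (d ^ t)⁻¹ * ‖x - y‖ ^ t := by positivity
      rw [pow_zero]
      linarith [habs x y]
    | succ n ih =>
      intro x hx y hy
      obtain ⟨i, hi, ex⟩ := h.exists_code hx
      obtain ⟨j, hj, ey⟩ := h.exists_code hy
      have hfx := h.apply_mem hx
      have hfy := h.apply_mem hy
      by_cases hij : i = j
      · subst hij
        have h1 : π x - π y = p i * (π (f x) - π (f y)) := by
          conv_lhs => rw [← ex, ← ey, hπ i hi _ hfx, hπ i hi _ hfy]
          ring
        have h2 := hlow i hi _ (h.mem_ball hfx) _ (h.mem_ball hfy)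
        rw [ex, ey] at h2
        have hsi := hs i hi
        have h3 : s i ^ t * ‖f x - f y‖ ^ t ≤ ‖x - y‖ ^ t := by
          rw [← Real.mul_rpow hsi.le (norm_nonneg _)]
          exact Real.rpow_le_rpow (by positivity) h2 ht.le
        rw [h1, abs_mul, abs_of_pos (hp0 i hi)]
        calc p i * |π (f x) - π (f y)|
            ≤ p i * ((d ^ t)⁻¹ * ‖f x - f y‖ ^ t + Λ ^ n) := by
              have := (hp0 i hi).le
              gcongr
              exact ih _ hfx _ hfy
          _ = (d ^ t)⁻¹ * (p i * ‖f x - f y‖ ^ t) + p i * Λ ^ n := by ring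
          _ ≤ (d ^ t)⁻¹ * (s i ^ t * ‖f x - f y‖ ^ t) + Λ * Λ ^ n := by
              gcongr
              · exact hps i hi
              · exact hpΛ i hi
          _ ≤ _ := by
              rw [pow_succ']
              gcongr
      · have h1 := hd i hi j hj hij _ (h.mem_closedBall hfx) _ (h.mem_closedBall hfy)
        rw [ex, ey] at h1
        have h2 : 1 ≤ (d ^ t)⁻¹ * ‖x - y‖ ^ t := by
          rw [inv_mul_eq_div, one_le_div (by positivity)]
          exact Real.rpow_le_rpow hd0.le h1 ht.le
        have : 0 ≤ Λ ^ (n + 1) := by positivity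
        linarith [habs x y]
  have hlimΛ := tendsto_pow_atTop_nhds_zero_of_lt_one hΛ0 hΛ1
  have hhol' : ∀ x ∈ X, ∀ y ∈ X, |π x - π y| ≤ (d ^ t)⁻¹ * ‖x - y‖ ^ t := by
    intro x hx y hy
    have := hlimΛ.const_add ((d ^ t)⁻¹ * ‖x - y‖ ^ t)
    rw [add_zero] at this
    exact ge_of_tendsto' this fun n => hhol n x hx y hy
  have htc : (t.toNNReal : ℝ) = t := Real.coe_toNNReal t ht.le
  have ht' : 0 < t.toNNReal := Real.toNNReal_pos.2 ht
  have hH : HolderOnWith (d ^ t)⁻¹.toNNReal t.toNNReal π X := by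
    intro x hx y hy
    rw [edist_dist, edist_dist, htc, ENNReal.ofReal_rpow_of_nonneg dist_nonneg ht.le]
    change _ ≤ ENNReal.ofReal (d ^ t)⁻¹ * _
    rw [← ENNReal.ofReal_mul (by positivity)]
    apply ENNReal.ofReal_le_ofReal
    rw [Real.dist_eq, dist_eq_norm]
    exact hhol' x hx y hy
  -- Self-similarity makes π(X) dense in [0, 1], hence all of it by compactness. A t-Hölder image of
  -- X then has dimension at least 1, so dim X ≥ t.
  have hdense : ∀ n : ℕ, ∀ y ∈ Icc (0 : ℝ) 1, ∃ x ∈ X, |π x - y| ≤ Λ ^ n := by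
    intro n
    induction n with
    | zero =>
      intro y hy
      obtain ⟨x, hx⟩ := h.nonempty_limitSet
      refine ⟨x, hx, ?_⟩
      rw [pow_zero]
      exact abs_le.2 ⟨by linarith [(hπb x).1, hy.2], by linarith [(hπb x).2, hy.1]⟩
    | succ n ih =>
      intro y hy
      obtain ⟨k, hk, h1, h2⟩ := exists_mem_partial_sum h.nonempty hy.1 (hpsum ▸ hy.2)
      have hpk := hp0 k hk
      obtain ⟨x, hx, hxy⟩ := ih ((y - ∑ j ∈ S with j < k, p j) / p k)
        ⟨div_nonneg (by linarith) hpk.le, (div_le_one hpk).2 (by linarith)⟩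
      refine ⟨ψ k x, h.branch_mem hx hk, ?_⟩
      rw [hπ k hk x hx]
      have : ∑ j ∈ S with j < k, p j + p k * π x - y =
          p k * (π x - (y - ∑ j ∈ S with j < k, p j) / p k) := by field_simp; ring
      rw [this, abs_mul, abs_of_pos hpk, pow_succ']
      exact mul_le_mul (hpΛ k hk) hxy (abs_nonneg _) hΛ0
  have hclosed : IsClosed (π '' X) := by
    refine (h.isCompact_limitSet.image_of_continuousOn ?_).isClosed
    exact (hH.uniformContinuousOn ht').continuousOn
  have hsurj : Icc (0 : ℝ) 1 ⊆ π '' X := by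
    intro y hy
    refine hclosed.closure_subset (Metric.mem_closure_iff.2 fun ε hε => ?_)
    obtain ⟨n, hn⟩ := ((hlimΛ.eventually (gt_mem_nhds hε))).exists
    obtain ⟨x, hx, hxy⟩ := hdense n y hy
    refine ⟨π x, mem_image_of_mem _ hx, ?_⟩
    rw [dist_comm, Real.dist_eq]
    exact hxy.trans_lt hn
  have h1 : (1 : ENNReal) ≤ dimH (π '' X) := by
    have : dimH (Icc (0 : ℝ) 1) = 1 := by
      rw [Real.dimH_of_nonempty_interior (by rw [interior_Icc]; exact ⟨1 / 2, by norm_num⟩)]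
      simp
    exact this ▸ dimH_mono hsurj
  have h2 := h1.trans (hH.dimH_image_le ht')
  rw [ENNReal.le_div_iff_mul_le (Or.inl (by simpa using ht)) (Or.inl (by simp)), one_mul] at h2
  exact h2

end IsBranchSystem
end HolderTract

/-! ### Chordal metric and Julia set -/

namespace HolderTract

/-- The inverse of the stereographic projection. -/
noncomputable def sphereEmb : OnePoint ℂ → EuclideanSpace ℝ (Fin 3)
  | some z => !₂[2 * z.re / (1 + ‖z‖ ^ 2), 2 * z.im / (1 + ‖z‖ ^ 2), (‖z‖ ^ 2 - 1) / (1 + ‖z‖ ^ 2)]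
  | none => !₂[0, 0, 1]

/-- The embedding in Euclidean space serves to get the triangle inequality. -/
theorem chordal_eq_dist (x y : OnePoint ℂ) : chordal x y = dist (sphereEmb x) (sphereEmb y) := by
  have hsq : ∀ z : ℂ, ‖z‖ ^ 2 = z.re ^ 2 + z.im ^ 2 := by
    intro z; rw [Complex.sq_norm, Complex.normSq_apply]; ring
  have key : ∀ a b : ℝ, 0 ≤ a → a ^ 2 = b → a = √b := by
    intro a b ha h; rw [← h, Real.sqrt_sq ha]
  rw [EuclideanSpace.dist_eq]
  apply key
  · match x, y with
    | some z, some w => simp only [chordal]; positivity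
    | some z, none => simp only [chordal]; positivity
    | none, some w => simp only [chordal]; positivity
    | none, none => simp only [chordal]; positivity
  · have hp : ∀ z : ℂ, 0 < 1 + (z.re ^ 2 + z.im ^ 2) := by intro z; positivity
    match x, y with
    | some z, some w =>
      have h1 := hp z
      have h2 := hp w
      simp only [chordal, sphereEmb, Fin.sum_univ_three, Real.dist_eq, sq_abs]
      rw [div_pow, mul_pow, mul_pow, Real.sq_sqrt (by positivity), Real.sq_sqrt (by positivity)]
      simp only [hsq, Complex.sub_re, Complex.sub_im]
      simp
      field_simp
      ring
    | some z, none =>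
      have h1 := hp z
      simp only [chordal, sphereEmb, Fin.sum_univ_three, Real.dist_eq, sq_abs]
      rw [div_pow, Real.sq_sqrt (by positivity)]
      simp only [hsq]
      simp
      field_simp
      ring
    | none, some w =>
      have h2 := hp w
      simp only [chordal, sphereEmb, Fin.sum_univ_three, Real.dist_eq, sq_abs]
      rw [div_pow, Real.sq_sqrt (by positivity)]
      simp only [hsq]
      simp
      field_simp
      ring
    | none, none => simp [chordal]

theorem chordal_comm (x y : OnePoint ℂ) : chordal x y = chordal y x := by
  rw [chordal_eq_dist, chordal_eq_dist, dist_comm]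

theorem chordal_triangle (x y z : OnePoint ℂ) : chordal x z ≤ chordal x y + chordal y z := by
  simp only [chordal_eq_dist]
  exact dist_triangle _ _ _

theorem chordal_coe_le (a b : ℂ) : chordal (a : OnePoint ℂ) b ≤ 2 * ‖a - b‖ := by
  change 2 * ‖a - b‖ / (√(1 + ‖a‖ ^ 2) * √(1 + ‖b‖ ^ 2)) ≤ _
  have h1 : 1 ≤ √(1 + ‖a‖ ^ 2) := Real.one_le_sqrt.2 (by linarith [sq_nonneg ‖a‖])
  have h2 : 1 ≤ √(1 + ‖b‖ ^ 2) := Real.one_le_sqrt.2 (by linarith [sq_nonneg ‖b‖])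
  exact div_le_self (by positivity) (one_le_mul_of_one_le_of_one_le h1 h2)

/-- If |b| > 2M + 1, then √(1 + |b|²) ≤ 1 + |b| ≤ 2(|b| - |a|), so the factor depending on b cancels
in the chordal distance. Points chordally close to a bounded orbit are therefore bounded. -/
theorem norm_le_of_chordal_lt {M : ℝ} {a b : ℂ} (ha : ‖a‖ ≤ M)
    (h : chordal (a : OnePoint ℂ) b < 1 / √(1 + M ^ 2)) : ‖b‖ ≤ 2 * M + 1 := by
  by_contra hcon
  push Not at hcon
  have hM : 0 ≤ M := (norm_nonneg a).trans ha
  refine absurd h (not_lt.2 ?_)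
  change _ ≤ 2 * ‖a - b‖ / (√(1 + ‖a‖ ^ 2) * √(1 + ‖b‖ ^ 2))
  have h1 : √(1 + ‖a‖ ^ 2) ≤ √(1 + M ^ 2) := Real.sqrt_le_sqrt (by gcongr)
  have h2 : √(1 + ‖b‖ ^ 2) ≤ 1 + ‖b‖ := by
    rw [Real.sqrt_le_left (by positivity)]
    nlinarith [norm_nonneg b]
  have h3 : ‖b‖ - ‖a‖ ≤ ‖a - b‖ := by rw [norm_sub_rev]; exact norm_sub_norm_le _ _
  have h4 : √(1 + ‖b‖ ^ 2) ≤ 2 * ‖a - b‖ := by linarith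
  rw [div_le_div_iff₀ (by positivity) (by positivity), one_mul, mul_comm]
  exact mul_le_mul h4 h1 (by positivity) (by positivity)

theorem differentiableAt_of_notMem_poles {f : ℂ → ℂ} (hf : MeromorphicNFOn f univ) {z : ℂ}
    (hz : z ∉ poles f) : DifferentiableAt ℂ f z :=
  ((hf (mem_univ z)).meromorphicOrderAt_nonneg_iff_analyticAt.1 (not_lt.1 hz)).differentiableAt

theorem differentiableOn_iterate {f : ℂ → ℂ} {U : Set ℂ} (hf : MeromorphicNFOn f univ)
    (hU : ∀ w ∈ U, ∀ n : ℕ, f^[n] w ∉ poles f) (n : ℕ) : DifferentiableOn ℂ f^[n] U := by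
  induction n with
  | zero => exact differentiableOn_id
  | succ n ih =>
    rw [Function.iterate_succ']
    exact fun w hw =>
      (differentiableAt_of_notMem_poles hf (hU w hw n)).comp_differentiableWithinAt w (ih w hw)

open Metric in
/-- Expanding repellers are contained in the Julia set. -/
theorem IsExpandingRepeller.subset_julia {f : ℂ → ℂ} {D X : Set ℂ} (hf : MeromorphicNFOn f univ)
    (hX : IsExpandingRepeller f D X) : X ⊆ julia f := by
  rintro z hz ⟨U, hUo, hzU, hpol, hnorm⟩
  obtain ⟨k, hk, G, hG⟩ := hnorm id
  obtain ⟨M, hM⟩ := isBounded_iff_forall_norm_le.1 hX.isCompact.isBounded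
  have horb : ∀ n : ℕ, f^[n] z ∈ X := by
    intro n
    induction n with
    | zero => exact hz
    | succ n ih =>
      rw [Function.iterate_succ_apply']
      exact hX.image_eq ▸ mem_image_of_mem f ih
  have hd := fun n => differentiableOn_iterate hf hpol n
  obtain ⟨ρ, hρ, hρU⟩ := nhds_basis_closedBall.mem_iff.1 (hUo.mem_nhds hzU)
  -- The limit G need not be known to be continuous. Points f^{k_j}(z) and f^{k_j}(w) are joined by
  -- five steps, through G(z), f^{k_{j₀}}(z), f^{k_{j₀}}(w) and G(w); only the continuity of the
  -- single iterate k_{j₀} is used.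
  set ε := 1 / √(1 + M ^ 2) / 5 with hε
  have hε0 : 0 < ε := by positivity
  obtain ⟨j₀, hj₀⟩ := eventually_atTop.1 (hG _ hρU (isCompact_closedBall z ρ) ε hε0)
  simp only [id] at hj₀
  have hcont : ContinuousAt f^[k j₀] z :=
    ((hd _).differentiableAt (hUo.mem_nhds hzU)).continuousAt
  obtain ⟨ρ₁, hρ₁, hball⟩ := nhds_basis_closedBall.mem_iff.1
    (hcont (ball_mem_nhds (f^[k j₀] z) (half_pos hε0)))
  set ρ₂ := min ρ ρ₁
  have hρ₂ : 0 < ρ₂ := lt_min hρ hρ₁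
  have hzK : z ∈ closedBall z ρ := mem_closedBall_self hρ.le
  have hbound : ∀ j ≥ j₀, ∀ w ∈ closedBall z ρ₂, ‖f^[k j] w‖ ≤ 2 * M + 1 := by
    intro j hj w hw
    have hwK : w ∈ closedBall z ρ := closedBall_subset_closedBall (min_le_left _ _) hw
    apply norm_le_of_chordal_lt (hM _ (horb (k j)))
    have h1 := hj₀ j hj w hwK
    have h2 := hj₀ j₀ le_rfl w hwK
    have h3 := hj₀ j hj z hzK
    have h4 := hj₀ j₀ le_rfl z hzK
    have h5 : chordal (f^[k j₀] z : OnePoint ℂ) (f^[k j₀] w) < ε := by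
      have : f^[k j₀] w ∈ ball (f^[k j₀] z) (ε / 2) :=
        hball (closedBall_subset_closedBall (min_le_right _ _) hw)
      rw [mem_ball_iff_norm'] at this
      linarith [chordal_coe_le (f^[k j₀] z) (f^[k j₀] w)]
    have t1 := chordal_triangle (f^[k j] z : OnePoint ℂ) (G z) (f^[k j] w)
    have t2 := chordal_triangle (G z) (f^[k j₀] z : OnePoint ℂ) (f^[k j] w)
    have t3 := chordal_triangle (f^[k j₀] z : OnePoint ℂ) (f^[k j₀] w : OnePoint ℂ) (f^[k j] w)
    have t4 := chordal_triangle (f^[k j₀] w : OnePoint ℂ) (G w) (f^[k j] w)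
    rw [chordal_comm (G z) (f^[k j₀] z : OnePoint ℂ)] at t2
    rw [chordal_comm (G w)] at t4
    have : 5 * ε = 1 / √(1 + M ^ 2) := by rw [hε]; ring
    rw [← this]
    linarith
  obtain ⟨c, r, hc, hr, hexp⟩ := hX.expanding
  -- Cauchy's estimate on a fixed disc bounds the derivatives at z, against their exponential
  -- growth.
  have hder : ∀ j ≥ j₀, c * r ^ j ≤ (2 * M + 1) / ρ₂ := by
    intro j hj
    calc c * r ^ j ≤ c * r ^ (k j) := by
          gcongr
          · exact hr.le
          · exact hk.id_le j
      _ ≤ ‖deriv f^[k j] z‖ := hexp _ z hz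
      _ ≤ _ := by
        apply Complex.norm_deriv_le_of_forall_mem_sphere_norm_le hρ₂
        · refine ((hd (k j)).mono ?_).diffContOnCl_ball subset_rfl
          exact (closedBall_subset_closedBall (min_le_left _ _)).trans hρU
        · exact fun w hw => hbound j hj w (sphere_subset_closedBall hw)
  have htop := (tendsto_pow_atTop_atTop_of_one_lt hr).const_mul_atTop hc
  obtain ⟨j, h1, h2⟩ := ((htop.eventually_gt_atTop ((2 * M + 1) / ρ₂)).and
    (eventually_ge_atTop j₀)).exists
  exact absurd (hder j h2) (not_le.2 h1)

end HolderTract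

/-! ### The Hölder property normalised by R|φ'(R)| -/

namespace HolderTract

/-- The scale `R |φ'(R)|` of `φ (Q_R)`. -/
noncomputable def tractScale (φ : ℂ → ℂ) (R : ℝ) : ℝ := R * ‖deriv φ (R : ℂ)‖

/-- Quantitative form of the Hölder property of a tract. -/
structure TractBounds (φ : ℂ → ℂ) (M m α R₀ : ℝ) : Prop where
  one_le_M : 1 ≤ M
  m_pos : 0 < m
  alpha_pos : 0 < α
  alpha_le : α ≤ 1
  one_lt : 1 < R₀
  scale_pos : ∀ R, R₀ ≤ R → 0 < tractScale φ R
  holder : ∀ R, R₀ ≤ R → ∀ z₁ ∈ Q (2 * R), ∀ z₂ ∈ Q (2 * R),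
    ‖φ z₁ - φ z₂‖ ≤ M * tractScale φ R * (‖z₁ - z₂‖ / R) ^ α
  diam_le : ∀ R, R₀ ≤ R → diamTract φ R ≤ M * tractScale φ R
  le_diam : ∀ R, R₀ ≤ R → tractScale φ R ≤ 2 * diamTract φ R
  norm_le : ∀ R, R₀ ≤ R → ∀ z ∈ Q (2 * R), ‖φ z‖ ≤ M * tractScale φ R
  le_norm : ∀ R, R₀ ≤ R → ∀ z ∈ Q (2 * R), kappa * R / 2 ≤ |z.im| → m * tractScale φ R ≤ ‖φ z‖
  tendsto : Tendsto (tractScale φ) atTop atTop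
  scale_le : ∀ R, R₀ ≤ R → tractScale φ R ≤ R ^ (10002 : ℝ)

theorem Q_subset_rightHalfPlane (R : ℝ) : Q R ⊆ rightHalfPlane := fun _ hz => hz.1

theorem Q_mono {R R' : ℝ} (h : R ≤ R') : Q R ⊆ Q R' := fun _ hz =>
  ⟨hz.1, by linarith [hz.2.1], by linarith [hz.2.2.1], by linarith [hz.2.2.2]⟩

theorem norm_sub_le_of_mem_Q {R : ℝ} {z w : ℂ} (hz : z ∈ Q R) (hw : w ∈ Q R) :
    ‖z - w‖ ≤ 4 * R := by
  refine (Complex.norm_le_abs_re_add_abs_im _).trans ?_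
  obtain ⟨h1, h2, h3, h4⟩ := hz
  obtain ⟨h5, h6, h7, h8⟩ := hw
  have : |(z - w).re| ≤ 2 * R := by rw [Complex.sub_re]; exact abs_le.2 ⟨by linarith, by linarith⟩
  have : |(z - w).im| ≤ 2 * R := by rw [Complex.sub_im]; exact abs_le.2 ⟨by linarith, by linarith⟩
  linarith

theorem div_mem_Q {R a : ℝ} (hR : 0 < R) {z : ℂ} (hz : z ∈ Q (R * a)) : z / (R : ℂ) ∈ Q a := by
  obtain ⟨h1, h2, h3, h4⟩ := hz
  refine ⟨?_, ?_, ?_, ?_⟩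
  · rw [Complex.div_ofReal_re]; positivity
  · rw [Complex.div_ofReal_re, div_lt_iff₀ hR]; linarith
  · rw [Complex.div_ofReal_im, lt_div_iff₀ hR]; linarith
  · rw [Complex.div_ofReal_im, div_lt_iff₀ hR]; linarith

theorem rescale_div {φ : ℂ → ℂ} {R : ℝ} (hR : 0 < R) (z : ℂ) :
    rescale φ R (z / (R : ℂ)) = φ z := by
  rw [rescale, mul_div_cancel₀ _ (Complex.ofReal_ne_zero.2 hR.ne')]

theorem kappa_pos : 0 < kappa := by unfold kappa; positivity

theorem kappa_lt_one : kappa < 1 := by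
  unfold kappa
  apply inv_lt_one_of_one_lt₀
  linarith [Real.pi_pos]

namespace IsTractModel

variable {Ω : Set ℂ} {τ φ : ℂ → ℂ}

theorem deriv_rescale (h : IsTractModel Ω τ φ) {R : ℝ} {z : ℂ}
    (hz : (R : ℂ) * z ∈ rightHalfPlane) : deriv (rescale φ R) z = R * deriv φ (R * z) := by
  have h1 : HasDerivAt (fun z : ℂ => (R : ℂ) * z) (R : ℂ) z := by
    simpa using (hasDerivAt_id z).const_mul (R : ℂ)
  have := (h.hasDerivAt hz).comp z h1
  rw [mul_comm]
  exact this.deriv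

theorem ofReal_mem {R : ℝ} (hR : 0 < R) : (R : ℂ) ∈ rightHalfPlane := by
  change 0 < (R : ℂ).re
  simpa using hR

theorem tendsto_norm (h : IsTractModel Ω τ φ) :
    Tendsto (fun R : ℝ => ‖φ (R : ℂ)‖) atTop atTop := by
  have h1 : Tendsto (fun R : ℝ => (R : ℂ)) atTop (Bornology.cobounded ℂ ⊓ 𝓟 rightHalfPlane) := by
    refine tendsto_inf.2 ⟨?_, tendsto_principal.2 ?_⟩
    · rw [← tendsto_norm_atTop_iff_cobounded]
      simpa using tendsto_abs_atTop_atTop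
    · filter_upwards [eventually_gt_atTop 0] with R hR using ofReal_mem hR
  exact tendsto_norm_atTop_iff_cobounded.2 (h.proper.comp h1)

theorem exists_tractBounds (h : IsTractModel Ω τ φ) (hH : IsHolder φ) :
    ∃ M m α R₀ : ℝ, TractBounds φ M m α R₀ := by
  obtain ⟨H, α, hH0, hα0, hα1, hHW⟩ := hH
  have hκ := kappa_pos
  have hκ1 := kappa_lt_one
  -- The hypothesis is applied at scale 2R to leave room around Q_R. There κ/4 corresponds to the
  -- height κR/2. Distortion between R and 2R costs the factor E.
  obtain ⟨m, hm, R₁, hR₁, hHol⟩ := hHW (kappa / 4) (by linarith) (by linarith)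
  set E := Real.exp (10000 * |Real.log 2|) with hE
  have hE1 : 1 ≤ E := Real.one_le_exp (by positivity)
  have hdouble : ∀ R : ℝ, 0 < R →
      ‖deriv φ ((2 * R : ℝ) : ℂ)‖ ≤ ‖deriv φ (R : ℂ)‖ * E ∧
      ‖deriv φ (R : ℂ)‖ ≤ ‖deriv φ ((2 * R : ℝ) : ℂ)‖ * E := by
    intro R hR
    have m1 := ofReal_mem hR
    have m2 : ((2 * R : ℝ) : ℂ) ∈ rightHalfPlane := ofReal_mem (by positivity)
    have e1 : (2 * R) / R = 2 := by field_simp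
    have e2 : R / (2 * R) = 2⁻¹ := by field_simp
    have h1 := h.norm_deriv_le_horizontal m1 m2 (by simp only [Complex.ofReal_im])
    have h2 := h.norm_deriv_le_horizontal m2 m1 (by simp only [Complex.ofReal_im])
    simp only [Complex.ofReal_re] at h1 h2
    rw [e1] at h1
    rw [e2, Real.log_inv, abs_neg] at h2
    exact ⟨h1, h2⟩
  have hscale : ∀ R : ℝ, 0 < R → 0 < tractScale φ R := fun R hR =>
    mul_pos hR (h.norm_deriv_pos (ofReal_mem hR))
  set M₀ := 2 * H * E with hM₀
  have hM₀0 : 0 < M₀ := by positivity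
  have hhol : ∀ R, R₁ ≤ R → ∀ z₁ ∈ Q (2 * R), ∀ z₂ ∈ Q (2 * R),
      ‖φ z₁ - φ z₂‖ ≤ M₀ * tractScale φ R * (‖z₁ - z₂‖ / R) ^ α := by
    intro R hR z₁ hz₁ z₂ hz₂
    have hR0 : 0 < R := by linarith
    have h2R : 0 < 2 * R := by linarith
    have h1 := (hHol (2 * R) (by linarith)).1 _ (div_mem_Q h2R (by rwa [mul_one]) : z₁ / _ ∈ Q 1) _
      (div_mem_Q h2R (by rwa [mul_one]) : z₂ / _ ∈ Q 1)
    rw [rescale_div h2R, rescale_div h2R, h.deriv_rescale (by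
      rw [mul_one]; exact ofReal_mem h2R), mul_one, norm_mul, Complex.norm_real, Real.norm_eq_abs,
      abs_of_pos h2R, ← sub_div, norm_div, Complex.norm_real, Real.norm_eq_abs,
      abs_of_pos h2R] at h1
    have hs := hscale R hR0
    calc _ ≤ _ := h1
      _ ≤ H * (2 * R * (‖deriv φ (R : ℂ)‖ * E)) * (‖z₁ - z₂‖ / R) ^ α := by
          gcongr
          · exact (hdouble R hR0).1
          · linarith
      _ = _ := by rw [hM₀, tractScale]; ring
  have hhol' : ∀ R, R₁ ≤ R → ∀ z₁ ∈ Q (2 * R), ∀ z₂ ∈ Q (2 * R),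
      ‖φ z₁ - φ z₂‖ ≤ 8 * M₀ * tractScale φ R := by
    intro R hR z₁ hz₁ z₂ hz₂
    have hR0 : 0 < R := by linarith
    have hs := hscale R hR0
    have h1 : (‖z₁ - z₂‖ / R) ^ α ≤ 8 := by
      have h2 : ‖z₁ - z₂‖ / R ≤ 8 := by
        rw [div_le_iff₀ hR0]
        linarith [norm_sub_le_of_mem_Q hz₁ hz₂]
      calc (‖z₁ - z₂‖ / R) ^ α ≤ 8 ^ α := Real.rpow_le_rpow (by positivity) h2 hα0.le
        _ ≤ 8 ^ (1 : ℝ) := Real.rpow_le_rpow_of_exponent_le (by norm_num) hα1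
        _ = 8 := Real.rpow_one _
    calc _ ≤ _ := hhol R hR z₁ hz₁ z₂ hz₂
      _ ≤ M₀ * tractScale φ R * 8 := by gcongr
      _ = _ := by ring
  have hdiam_le : ∀ R, R₁ ≤ R → diamTract φ R ≤ 8 * M₀ * tractScale φ R := by
    intro R hR
    have hR0 : 0 < R := by linarith
    have hs := hscale R hR0
    refine Metric.diam_le_of_forall_dist_le (by positivity) ?_
    rintro _ ⟨z, hz, rfl⟩ _ ⟨w, hw, rfl⟩
    rw [dist_eq_norm]
    have hsub := Q_mono (by linarith : R ≤ 2 * R)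
    exact hhol' R hR z (hsub hz) w (hsub hw)
  have hbdd : ∀ R, R₁ ≤ R → Bornology.IsBounded (φ '' Q R) := by
    intro R hR
    have hsub := Q_mono (by linarith : R ≤ 2 * R)
    refine Metric.isBounded_iff.2 ⟨8 * M₀ * tractScale φ R, ?_⟩
    rintro _ ⟨z, hz, rfl⟩ _ ⟨w, hw, rfl⟩
    rw [dist_eq_norm]
    exact hhol' R hR z (hsub hz) w (hsub hw)
  have hle_diam : ∀ R, R₁ ≤ R → tractScale φ R ≤ 2 * diamTract φ R := by
    intro R hR
    have hR0 : 0 < R := by linarith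
    -- Cauchy's estimate on this disc bounds |φ'(R)| by diam Ω_R / (R/2).
    have hball : Metric.closedBall (R : ℂ) (R / 2) ⊆ Q R := by
      intro w hw
      rw [mem_closedBall_iff_norm] at hw
      have h1 := abs_le.1 ((Complex.abs_re_le_norm _).trans hw)
      have h2 := abs_le.1 ((Complex.abs_im_le_norm _).trans hw)
      simp only [Complex.sub_re, Complex.sub_im, Complex.ofReal_re, Complex.ofReal_im] at h1 h2
      exact ⟨by linarith, by linarith, by linarith, by linarith⟩
    have hRQ : (R : ℂ) ∈ Q R := hball (Metric.mem_closedBall_self (by positivity))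
    have h1 := Complex.norm_deriv_le_of_forall_mem_sphere_norm_le (c := (R : ℂ)) (R := R / 2)
      (C := diamTract φ R) (f := fun z => φ z - φ (R : ℂ)) (by positivity)
      (((h.holo_inv.mono (hball.trans (Q_subset_rightHalfPlane R))).sub_const _).diffContOnCl_ball
        subset_rfl) (by
        intro z hz
        rw [← dist_eq_norm]
        exact Metric.dist_le_diam_of_mem (hbdd R hR) (mem_image_of_mem _
          (hball (Metric.sphere_subset_closedBall hz))) (mem_image_of_mem _ hRQ))
    rw [deriv_sub_const, le_div_iff₀ (by positivity)] at h1
    rw [tractScale]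
    linarith
  have hle_norm : ∀ R, R₁ ≤ R → ∀ z ∈ Q (2 * R), kappa * R / 2 ≤ |z.im| →
      (m / (2 * E)) * tractScale φ R ≤ ‖φ z‖ := by
    intro R hR z hz him
    have hR0 : 0 < R := by linarith
    have h2R : 0 < 2 * R := by linarith
    have h1 := (hHol (2 * R) (by linarith)).2 (z / ((2 * R : ℝ) : ℂ)) ⟨div_mem_Q h2R
      (by rwa [mul_one]), by
        rintro ⟨-, -, h3, h4⟩
        rw [Complex.div_ofReal_im] at h3 h4
        have h5 := abs_lt.2 ⟨h3, h4⟩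
        rw [abs_div, abs_of_pos h2R, div_lt_iff₀ h2R] at h5
        linarith⟩
    rw [rescale_div h2R] at h1
    have h2 := hle_diam (2 * R) (by linarith)
    have h3 : tractScale φ R ≤ E * tractScale φ (2 * R) := by
      have := (hdouble R hR0).2
      have hn := norm_nonneg (deriv φ ((2 * R : ℝ) : ℂ))
      simp only [tractScale]
      nlinarith [mul_le_mul_of_nonneg_left this hR0.le, mul_nonneg hR0.le (mul_nonneg hn
        (by linarith : 0 ≤ E))]
    calc (m / (2 * E)) * tractScale φ R ≤ (m / (2 * E)) * (E * tractScale φ (2 * R)) := by gcongr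
      _ = m * (tractScale φ (2 * R) / 2) := by field_simp
      _ ≤ m * diamTract φ (2 * R) := by gcongr; linarith
      _ ≤ _ := h1
  have h1Q : ∀ R, R₁ ≤ R → (1 : ℂ) ∈ Q (2 * R) := fun R hR =>
    ⟨by simp, by simp; linarith, by simp; linarith, by simp; linarith⟩
  have htend : Tendsto (tractScale φ) atTop atTop := by
    have h1 : Tendsto (fun R : ℝ => (8 * M₀)⁻¹ * (‖φ (R : ℂ)‖ - ‖φ 1‖)) atTop atTop :=
      (tendsto_atTop_add_const_right _ _ h.tendsto_norm).const_mul_atTop (by positivity)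
    refine tendsto_atTop_mono' _ ?_ h1
    filter_upwards [eventually_ge_atTop R₁] with R hR
    have hR0 : 0 < R := by linarith
    have hRQ : (R : ℂ) ∈ Q (2 * R) := by
      refine ⟨?_, ?_, ?_, ?_⟩ <;> simp <;> linarith
    have h2 := hhol' R hR _ hRQ _ (h1Q R hR)
    have h3 := norm_sub_norm_le (φ (R : ℂ)) (φ 1)
    rw [inv_mul_le_iff₀ (by positivity)]
    linarith
  obtain ⟨R₂, hR₂⟩ := eventually_atTop.1 (htend.eventually_ge_atTop ‖φ 1‖)
  have h1m : (1 : ℂ) ∈ rightHalfPlane := by change 0 < (1 : ℂ).re; simp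
  have hnd := h.norm_deriv_pos h1m
  -- R₂ makes the scale exceed |φ(1)|, so that oscillation bounds become norm bounds. Having R ≥
  -- |φ'(1)| lets one factor R absorb that constant: the exponent 10002 is 10000 from distortion
  -- plus two.
  set R₀ := max (max 2 R₁) (max R₂ ‖deriv φ 1‖) with hR₀
  have g1 : 2 ≤ R₀ := (le_max_left _ _).trans (le_max_left _ _)
  have g2 : R₁ ≤ R₀ := (le_max_right _ _).trans (le_max_left _ _)
  have g3 : R₂ ≤ R₀ := (le_max_left _ _).trans (le_max_right _ _)
  have g4 : ‖deriv φ 1‖ ≤ R₀ := (le_max_right _ _).trans (le_max_right _ _)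
  refine ⟨8 * M₀ + 1, m / (2 * E), α, R₀, ⟨by linarith, by positivity, hα0, hα1, by linarith,
    fun R hR => hscale R (by linarith), ?_, ?_, fun R hR => hle_diam R (by linarith), ?_,
    fun R hR => hle_norm R (by linarith), htend, ?_⟩⟩
  · intro R hR z₁ hz₁ z₂ hz₂
    have hs := hscale R (by linarith)
    refine (hhol R (by linarith) z₁ hz₁ z₂ hz₂).trans ?_
    have hR0 : 0 < R := by linarith
    gcongr
    linarith
  · intro R hR
    have hs := hscale R (by linarith)
    refine (hdiam_le R (by linarith)).trans ?_
    gcongr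
    linarith
  · intro R hR z hz
    have h2 := hhol' R (by linarith) z hz 1 (h1Q R (by linarith))
    have h3 := norm_sub_norm_le (φ z) (φ 1)
    have h4 := hR₂ R (by linarith)
    linarith
  · intro R hR
    have hR1 : 1 ≤ R := by linarith
    have hR0 : 0 < R := by linarith
    have h2 := h.norm_deriv_le_horizontal h1m (ofReal_mem hR0) (by simp)
    simp only [Complex.ofReal_re, Complex.one_re, div_one] at h2
    rw [abs_of_nonneg (Real.log_nonneg hR1), mul_comm (10000 : ℝ), ← Real.rpow_def_of_pos hR0] at h2
    calc tractScale φ R ≤ R * (R * R ^ (10000 : ℝ)) := by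
          rw [tractScale]
          gcongr
          refine h2.trans ?_
          gcongr
          linarith
      _ = R ^ (10002 : ℝ) := by
          rw [show (10002 : ℝ) = 1 + (1 + 10000) by norm_num, Real.rpow_add hR0, Real.rpow_add hR0,
            Real.rpow_one]

end IsTractModel
end HolderTract

/-! ### Integral means and the function β_∞ -/

namespace HolderTract

/-- The modulus of the derivative of `g_R` at `1/R + iy`. -/
noncomputable def gSpeed (φ : ℂ → ℂ) (R y : ℝ) : ℝ :=
  R * ‖deriv φ (1 + ((R * y : ℝ) : ℂ) * Complex.I)‖ / diamTract φ R

theorem one_add_mem (s : ℝ) : (1 + (s : ℂ) * Complex.I) ∈ rightHalfPlane := by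
  change 0 < (1 + (s : ℂ) * Complex.I).re
  simp

namespace IsTractModel

variable {Ω : Set ℂ} {τ φ : ℂ → ℂ}

theorem norm_deriv_g (h : IsTractModel Ω τ φ) {R : ℝ} (hR : 0 < R) (y : ℝ) :
    ‖deriv (g φ R) (((1 / R : ℝ) : ℂ) + (y : ℂ) * Complex.I)‖ = gSpeed φ R y := by
  have hRc : (R : ℂ) ≠ 0 := Complex.ofReal_ne_zero.2 hR.ne'
  have e : (R : ℂ) * (((1 / R : ℝ) : ℂ) + (y : ℂ) * Complex.I) =
      1 + ((R * y : ℝ) : ℂ) * Complex.I := by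
    push_cast
    field_simp
  have h1 : deriv (g φ R) (((1 / R : ℝ) : ℂ) + (y : ℂ) * Complex.I) =
      R * deriv φ (1 + ((R * y : ℝ) : ℂ) * Complex.I) / (diamTract φ R : ℂ) := by
    rw [← e, ← h.deriv_rescale (by rw [e]; exact one_add_mem _)]
    exact deriv_div_const _
  rw [h1, norm_div, norm_mul, Complex.norm_real, Complex.norm_real, Real.norm_eq_abs,
    Real.norm_eq_abs, abs_of_pos hR, gSpeed, abs_of_nonneg (by exact Metric.diam_nonneg)]

theorem continuous_gSpeed (h : IsTractModel Ω τ φ) (R : ℝ) : Continuous (gSpeed φ R) := by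
  unfold gSpeed
  refine Continuous.div_const (continuous_const.mul (Continuous.norm ?_)) _
  exact h.differentiableOn_deriv.continuousOn.comp_continuous (by fun_prop)
    fun y => one_add_mem _

theorem segMean_eq (h : IsTractModel Ω τ φ) {R : ℝ} (hR : 0 < R) (t a b : ℝ) :
    segMean φ R t a b = ∫ y in a..b, gSpeed φ R y ^ t := by
  unfold segMean
  simp only [h.norm_deriv_g hR]

end IsTractModel

namespace TractBounds

variable {Ω : Set ℂ} {τ φ : ℂ → ℂ} {M m α R₀ : ℝ}

theorem diam_pos (hb : TractBounds φ M m α R₀) {R : ℝ} (hR : R₀ ≤ R) : 0 < diamTract φ R := by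
  have := hb.scale_pos R hR
  linarith [hb.le_diam R hR]

/-- Cauchy estimate for `φ'` at distance at least one from the boundary of the half-plane. -/
theorem norm_deriv_le (hb : TractBounds φ M m α R₀) (h : IsTractModel Ω τ φ) {R : ℝ} (hR : R₀ ≤ R)
    {z : ℂ} (h1 : 1 ≤ z.re) (h2 : z.re ≤ 3 * R) (h3 : |z.im| ≤ 3 / 2 * R) :
    ‖deriv φ z‖ ≤ 2 * M * tractScale φ R * (1 / R) ^ α := by
  have hR1 : 1 < R := hb.one_lt.trans_le hR
  have hR0 : 0 < R := by linarith
  obtain ⟨h4, h5⟩ := abs_le.1 h3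
  have hball : Metric.closedBall z (1 / 2) ⊆ Q (2 * R) := by
    intro w hw
    rw [mem_closedBall_iff_norm] at hw
    have h1 := abs_le.1 ((Complex.abs_re_le_norm _).trans hw)
    have h2 := abs_le.1 ((Complex.abs_im_le_norm _).trans hw)
    simp only [Complex.sub_re, Complex.sub_im] at h1 h2
    exact ⟨by linarith, by linarith, by linarith, by linarith⟩
  have hzQ : z ∈ Q (2 * R) := hball (Metric.mem_closedBall_self (by norm_num))
  have hs := hb.scale_pos R hR
  have hM := hb.one_le_M
  have h1 := Complex.norm_deriv_le_of_forall_mem_sphere_norm_le (c := z) (R := 1 / 2)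
      (C := M * tractScale φ R * (1 / R) ^ α) (f := fun w => φ w - φ z) (by positivity)
      (((h.holo_inv.mono (hball.trans (Q_subset_rightHalfPlane _))).sub_const _).diffContOnCl_ball
        subset_rfl) (by
        intro w hw
        refine (hb.holder R hR w (hball (Metric.sphere_subset_closedBall hw)) z hzQ).trans ?_
        rw [mem_sphere_iff_norm.1 hw]
        have := hb.alpha_pos.le
        gcongr
        norm_num)
  rw [deriv_sub_const] at h1
  linarith

/-- The lower bound is distortion between 1 + iRy and R, with one extra power of R absorbing M
e^{10000}. The upper bound combines the Cauchy and Hölder estimates to 4M R^{1-α}, and R^{α/2}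
absorbs 4M. -/
theorem eventually_gSpeed_bounds (hb : TractBounds φ M m α R₀) (h : IsTractModel Ω τ φ) :
    ∀ᶠ R in atTop, ∀ y : ℝ, |y| ≤ 1 →
      R ^ (-10001 : ℝ) ≤ gSpeed φ R y ∧ gSpeed φ R y ≤ R ^ (1 - α / 2) := by
  have hM := hb.one_le_M
  have hα := hb.alpha_pos
  have t1 : ∀ᶠ R : ℝ in atTop, 4 * M ≤ R ^ (α / 2) :=
    (tendsto_rpow_atTop (by positivity)).eventually_ge_atTop _
  filter_upwards [t1, eventually_ge_atTop (M * Real.exp 10000), eventually_ge_atTop R₀]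
    with R hR1 hR2 hR y hy
  have hRl : 1 < R := hb.one_lt.trans_le hR
  have hR0 : 0 < R := by linarith
  have hs := hb.scale_pos R hR
  have hd := hb.diam_pos hR
  have hle := hb.le_diam R hR
  have hdl := hb.diam_le R hR
  have hyR : |R * y| ≤ R := by
    rw [abs_mul, abs_of_pos hR0]
    exact mul_le_of_le_one_right hR0.le hy
  set z : ℂ := 1 + ((R * y : ℝ) : ℂ) * Complex.I with hz
  have hzre : z.re = 1 := by simp [hz]
  have hzim : z.im = R * y := by simp [hz]
  have hzm : z ∈ rightHalfPlane := one_add_mem _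
  unfold gSpeed
  rw [← hz]
  constructor
  · have h1 := h.norm_deriv_le hzm (w := (R : ℂ)) (IsTractModel.ofReal_mem hR0)
    rw [hzre, hzim, Complex.ofReal_re, Complex.ofReal_im, div_one, zero_sub, abs_neg,
      abs_of_nonneg (Real.log_nonneg hRl.le)] at h1
    have h2 : Real.exp (10000 * (Real.log R + |R * y| / R)) ≤ R ^ (10000 : ℝ) * Real.exp 10000 := by
      rw [Real.rpow_def_of_pos hR0, ← Real.exp_add, Real.exp_le_exp]
      have : |R * y| / R ≤ 1 := by rwa [div_le_one hR0]
      linarith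
    have hE := Real.exp_pos 10000
    have hn := h.norm_deriv_pos hzm
    have h3 : tractScale φ R ≤ R * ‖deriv φ z‖ * (R ^ (10000 : ℝ) * Real.exp 10000) := by
      rw [tractScale, mul_assoc]
      gcongr
      exact h1.trans (by gcongr)
    rw [le_div_iff₀ hd]
    have h4 : R ^ (-10001 : ℝ) * (R ^ (10000 : ℝ) * R) = 1 := by
      rw [← Real.rpow_add_one hR0.ne', ← Real.rpow_add hR0]
      norm_num
    calc R ^ (-10001 : ℝ) * diamTract φ R
        ≤ R ^ (-10001 : ℝ) * (M * (R * ‖deriv φ z‖ * (R ^ (10000 : ℝ) * Real.exp 10000))) := by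
          gcongr
          exact hdl.trans (by gcongr)
      _ = R ^ (-10001 : ℝ) * R ^ (10000 : ℝ) * (M * Real.exp 10000) * (R * ‖deriv φ z‖) := by ring
      _ ≤ R ^ (-10001 : ℝ) * R ^ (10000 : ℝ) * R * (R * ‖deriv φ z‖) := by gcongr
      _ = R * ‖deriv φ z‖ := by rw [mul_assoc (R ^ (-10001 : ℝ)), h4, one_mul]
  · have h1 := hb.norm_deriv_le h hR (z := z) hzre.ge (by rw [hzre]; linarith)
      (by rw [hzim]; linarith)
    rw [div_le_iff₀ hd]
    have e1 : R * (1 / R) ^ α * R ^ (α / 2) = R ^ (1 - α / 2) := by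
      rw [one_div, Real.inv_rpow hR0.le, ← Real.rpow_neg hR0.le]
      nth_rw 1 [← Real.rpow_one R]
      rw [← Real.rpow_add hR0, ← Real.rpow_add hR0]
      ring_nf
    calc R * ‖deriv φ z‖ ≤ R * (2 * M * tractScale φ R * (1 / R) ^ α) := by gcongr
      _ ≤ R * (2 * M * (2 * diamTract φ R) * (1 / R) ^ α) := by gcongr
      _ = R * (1 / R) ^ α * (4 * M) * diamTract φ R := by ring
      _ ≤ R * (1 / R) ^ α * R ^ (α / 2) * diamTract φ R := by gcongr
      _ = _ := by rw [e1]

theorem eventually_segMean_bounds (hb : TractBounds φ M m α R₀) (h : IsTractModel Ω τ φ) :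
    ∀ᶠ R in atTop, ∀ a b : ℝ, -1 ≤ a → a ≤ b → b ≤ 1 → ∀ t t' : ℝ, t ≤ t' →
      (R ^ (-10001 : ℝ)) ^ (t' - t) * segMean φ R t a b ≤ segMean φ R t' a b ∧
      segMean φ R t' a b ≤ (R ^ (1 - α / 2)) ^ (t' - t) * segMean φ R t a b := by
  filter_upwards [hb.eventually_gSpeed_bounds h, eventually_gt_atTop 0]
    with R hR hR0 a b ha hab hb1 t t' htt
  have hpos : ∀ y ∈ Icc a b, 0 < gSpeed φ R y := fun y hy =>
    (Real.rpow_pos_of_pos hR0 _).trans_le (hR y (abs_le.2 ⟨by linarith [hy.1], by linarith [hy.2]⟩)).1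
  have hint : ∀ s : ℝ, IntervalIntegrable (fun y => gSpeed φ R y ^ s) MeasureTheory.volume a b := by
    intro s
    apply ContinuousOn.intervalIntegrable_of_Icc hab
    exact (h.continuous_gSpeed R).continuousOn.rpow_const fun y hy => Or.inl (hpos y hy).ne'
  rw [h.segMean_eq hR0, h.segMean_eq hR0, ← intervalIntegral.integral_const_mul,
    ← intervalIntegral.integral_const_mul]
  have hsplit : ∀ y ∈ Icc a b, gSpeed φ R y ^ t' = gSpeed φ R y ^ (t' - t) * gSpeed φ R y ^ t := by
    intro y hy
    rw [← Real.rpow_add (hpos y hy)]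
    ring_nf
  constructor
  · refine intervalIntegral.integral_mono_on hab ((hint t).const_mul _) (hint t') fun y hy => ?_
    have hp := hpos y hy
    have := (hR y (abs_le.2 ⟨by linarith [hy.1], by linarith [hy.2]⟩)).1
    rw [hsplit y hy]
    exact mul_le_mul_of_nonneg_right (Real.rpow_le_rpow (by positivity) this (by linarith))
      (by positivity)
  · refine intervalIntegral.integral_mono_on hab (hint t') ((hint t).const_mul _) fun y hy => ?_
    have hp := hpos y hy
    have := (hR y (abs_le.2 ⟨by linarith [hy.1], by linarith [hy.2]⟩)).2
    rw [hsplit y hy]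
    exact mul_le_mul_of_nonneg_right (Real.rpow_le_rpow hp.le this (by linarith)) (by positivity)

theorem meanI_zero (φ : ℂ → ℂ) (R : ℝ) : meanI φ R 0 = 1 - kappa := by
  simp [meanI, segMean]
  ring

/-- Raising the exponent from t to t' multiplies the integrand by |g_R'|^{t'-t}. That the upper
slope 1 - α/2 is below 1 is the point: it makes β_∞(t) - t strictly decreasing. -/
theorem eventually_betaR_bounds (hb : TractBounds φ M m α R₀) (h : IsTractModel Ω τ φ) :
    ∀ᶠ R in atTop, ∀ t t' : ℝ, 0 ≤ t → t ≤ t' →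
      betaR φ R t - 10001 * (t' - t) ≤ betaR φ R t' ∧
      betaR φ R t' ≤ betaR φ R t + (1 - α / 2) * (t' - t) := by
  have hκ := kappa_pos
  have hκ1 := kappa_lt_one
  filter_upwards [hb.eventually_segMean_bounds h, eventually_gt_atTop 1] with R hR hR1
  have hR0 : 0 < R := by linarith
  have hlog : 0 < Real.log R := Real.log_pos hR1
  have hmean : ∀ t t' : ℝ, t ≤ t' →
      (R ^ (-10001 : ℝ)) ^ (t' - t) * meanI φ R t ≤ meanI φ R t' ∧
      meanI φ R t' ≤ (R ^ (1 - α / 2)) ^ (t' - t) * meanI φ R t := by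
    intro t t' htt
    have h1 := hR (-1) (-kappa) le_rfl (by linarith) (by linarith) t t' htt
    have h2 := hR kappa 1 (by linarith) hκ1.le le_rfl t t' htt
    unfold meanI
    rw [mul_max_of_nonneg _ _ (by positivity), mul_max_of_nonneg _ _ (by positivity)]
    exact ⟨max_le_max h1.1 h2.1, max_le_max h1.2 h2.2⟩
  have hpos : ∀ t, 0 ≤ t → 0 < meanI φ R t := by
    intro t ht
    have h1 := (hmean 0 t ht).1
    rw [meanI_zero] at h1
    refine lt_of_lt_of_le ?_ h1
    have : 0 < 1 - kappa := by linarith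
    positivity
  intro t t' ht htt
  obtain ⟨h1, h2⟩ := hmean t t' htt
  have ht0 := hpos t ht
  have ht'0 := hpos t' (ht.trans htt)
  have h3 := Real.log_le_log (by positivity) h1
  have h4 := Real.log_le_log ht'0 h2
  rw [Real.log_mul (by positivity) ht0.ne', Real.log_rpow (by positivity), Real.log_rpow hR0]
    at h3 h4
  unfold betaR
  constructor
  · rw [le_div_iff₀ hlog, sub_mul, div_mul_cancel₀ _ hlog.ne']
    linarith
  · rw [div_le_iff₀ hlog, add_mul, div_mul_cancel₀ _ hlog.ne']
    linarith

theorem tendsto_betaR_zero (φ : ℂ → ℂ) : Tendsto (fun R => betaR φ R 0) atTop (𝓝 0) := by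
  unfold betaR
  simp only [meanI_zero]
  exact Real.tendsto_log_atTop.const_div_atTop _

end TractBounds

/-- Comparison of upper limits, up to an additive constant. -/
theorem limsup_coe_le_of_eventually_le {u v : ℝ → ℝ} {a b c : ℝ}
    (ha : limsup (fun R => (u R : EReal)) atTop = a)
    (hb : limsup (fun R => (v R : EReal)) atTop = b) (huv : ∀ᶠ R in atTop, u R ≤ v R + c) :
    a ≤ b + c := by
  refine le_of_forall_pos_le_add fun ε hε => ?_
  have h1 : ∀ᶠ R in atTop, (v R : EReal) < ((b + ε : ℝ) : EReal) := by
    have hlt : limsup (fun R => (v R : EReal)) atTop < ((b + ε : ℝ) : EReal) := by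
      rw [hb]
      exact_mod_cast (by linarith : b < b + ε)
    exact eventually_lt_of_limsup_lt hlt
  have h2 : limsup (fun R => (u R : EReal)) atTop ≤ ((b + c + ε : ℝ) : EReal) := by
    apply limsup_le_of_le
    · isBoundedDefault
    filter_upwards [h1, huv] with R h3 h4
    have h3' : v R < b + ε := by exact_mod_cast h3
    exact_mod_cast (by linarith : u R ≤ b + c + ε)
  rw [ha] at h2
  exact_mod_cast h2

/-- Comparison with t = 0, where I_R is the constant 1 - κ, shows that the extended-real upper
limits are finite. -/
theorem TractBounds.exists_beta {Ω : Set ℂ} {τ φ : ℂ → ℂ} {M m α R₀ : ℝ}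
    (hb : TractBounds φ M m α R₀) (h : IsTractModel Ω τ φ) :
    ∃ β : ℝ → ℝ, (∀ t, 0 ≤ t → betaInf φ t = β t) ∧ β 0 = 0 ∧ ∀ t t' : ℝ, 0 ≤ t → t ≤ t' →
      β t - 10001 * (t' - t) ≤ β t' ∧ β t' ≤ β t + (1 - α / 2) * (t' - t) := by
  have hev := hb.eventually_betaR_bounds h
  have h0 := tendsto_betaR_zero φ
  have hfin : ∀ t, 0 ≤ t → betaInf φ t = ((betaInf φ t).toReal : EReal) := by
    intro t ht
    have hlow : ((-1 - 10001 * t : ℝ) : EReal) ≤ betaInf φ t := by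
      unfold betaInf
      apply le_limsup_of_frequently_le
      · refine Eventually.frequently ?_
        filter_upwards [hev, h0.eventually (lt_mem_nhds (by norm_num : (-1 : ℝ) < 0))] with R h1 h2
        have := (h1 0 t le_rfl ht).1
        exact_mod_cast (by linarith : -1 - 10001 * t ≤ betaR φ R t)
      · isBoundedDefault
    have hup : betaInf φ t ≤ ((1 + (1 - α / 2) * t : ℝ) : EReal) := by
      unfold betaInf
      apply limsup_le_of_le
      · isBoundedDefault
      filter_upwards [hev, h0.eventually (gt_mem_nhds (by norm_num : (0 : ℝ) < 1))] with R h1 h2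
      have := (h1 0 t le_rfl ht).2
      exact_mod_cast (by linarith : betaR φ R t ≤ 1 + (1 - α / 2) * t)
    rw [EReal.coe_toReal]
    · exact (hup.trans_lt (EReal.coe_lt_top _)).ne
    · exact ((EReal.bot_lt_coe _).trans_le hlow).ne'
  refine ⟨fun t => (betaInf φ t).toReal, hfin, ?_, fun t t' ht htt => ⟨?_, ?_⟩⟩
  · have : betaInf φ 0 = ((0 : ℝ) : EReal) :=
      ((continuous_coe_real_ereal.tendsto 0).comp h0).limsup_eq
    simp [this]
  · have := limsup_coe_le_of_eventually_le (hfin t ht) (hfin t' (ht.trans htt))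
      (c := 10001 * (t' - t)) (hev.mono fun R hR => by linarith [(hR t t' ht htt).1])
    linarith
  · exact limsup_coe_le_of_eventually_le (hfin t' (ht.trans htt)) (hfin t ht)
      (hev.mono fun R hR => (hR t t' ht htt).2)

/-- A function decreasing at least linearly at bounded rate has a unique zero. -/
theorem exists_unique_zero {b : ℝ → ℝ} {a A : ℝ} (ha : 0 < a) (h0 : 0 ≤ b 0)
    (hb : ∀ t t' : ℝ, 0 ≤ t → t ≤ t' → b t - A * (t' - t) ≤ b t' ∧ b t' ≤ b t - a * (t' - t)) :
    ∃ Θ, 0 ≤ Θ ∧ b Θ = 0 ∧ ∀ t, 0 ≤ t → b t = 0 → t = Θ := by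
  have hcont : ContinuousOn b (Ici 0) := by
    have hL : LipschitzOnWith (max A 0).toNNReal b (Ici 0) := by
      refine LipschitzOnWith.of_dist_le_mul fun x hx y hy => ?_
      rw [Real.coe_toNNReal _ (le_max_right _ _), Real.dist_eq, Real.dist_eq]
      have hA := le_max_left A 0
      rcases le_total x y with hxy | hxy
      · obtain ⟨h1, h2⟩ := hb x y hx hxy
        rw [abs_sub_comm x, abs_of_nonneg (sub_nonneg.2 hxy), abs_le]
        have := mul_le_mul_of_nonneg_right hA (sub_nonneg.2 hxy)
        have := mul_nonneg ha.le (sub_nonneg.2 hxy)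
        constructor <;> linarith
      · obtain ⟨h1, h2⟩ := hb y x hy hxy
        rw [abs_of_nonneg (sub_nonneg.2 hxy), abs_le]
        have := mul_le_mul_of_nonneg_right hA (sub_nonneg.2 hxy)
        have := mul_nonneg ha.le (sub_nonneg.2 hxy)
        constructor <;> linarith
    exact hL.continuousOn
  have hT : 0 ≤ b 0 / a := by positivity
  have hTb : b (b 0 / a) ≤ 0 := by
    have := (hb 0 (b 0 / a) le_rfl hT).2
    rw [sub_zero, mul_div_cancel₀ _ ha.ne', sub_self] at this
    exact this
  obtain ⟨Θ, hΘ, hz⟩ := intermediate_value_Icc' hT (hcont.mono Icc_subset_Ici_self) ⟨hTb, h0⟩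
  refine ⟨Θ, hΘ.1, hz, fun t ht htz => ?_⟩
  rcases lt_trichotomy t Θ with hlt | heq | hlt
  · have := (hb t Θ ht hlt.le).2
    nlinarith [mul_pos ha (sub_pos.2 hlt)]
  · exact heq
  · have := (hb Θ t hΘ.1 hlt.le).2
    nlinarith [mul_pos ha (sub_pos.2 hlt)]

end HolderTract

/-! ### Nonnegativity of β_∞(1) -/

namespace HolderTract

/-- A positive function which grows by a factor `exp (B R ^ (-ε))` at most between `q R` and `R`
is bounded along the sequence `R / q ^ n`. -/
theorem exists_frequently_le_of_le_mul_exp {v : ℝ → ℝ} {q B ε R₁ : ℝ} (hq : 0 < q) (hq1 : q < 1)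
    (hB : 0 ≤ B) (hε : 0 < ε) (hR₁ : 0 < R₁) (hv : ∀ R, 0 ≤ v R)
    (hstep : ∀ R, R₁ ≤ R → v R ≤ v (q * R) * Real.exp (B * R ^ (-ε))) :
    ∃ A, ∃ᶠ R in atTop, v R ≤ A := by
  set p := q ^ ε with hp
  have hp0 : 0 < p := by positivity
  have hp1 : p < 1 := Real.rpow_lt_one hq.le hq1 hε
  -- K dominates the geometric series of the exponents B(R₁/q^n)^{-ε} = B R₁^{-ε} p^n.
  set K := B * R₁ ^ (-ε) / (1 - p) with hK
  have h1p : 0 < 1 - p := by linarith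
  have hK0 : 0 ≤ K := by positivity
  have hbound : ∀ n : ℕ, v (R₁ / q ^ n) ≤ v R₁ * Real.exp (K * (1 - p ^ n)) := by
    intro n
    induction n with
    | zero => simp
    | succ n ih =>
      have hge : R₁ ≤ R₁ / q ^ (n + 1) :=
        le_div_self hR₁.le (by positivity) (pow_le_one₀ hq.le hq1.le)
      have e1 : q * (R₁ / q ^ (n + 1)) = R₁ / q ^ n := by rw [pow_succ]; field_simp
      have e2 : (R₁ / q ^ (n + 1)) ^ (-ε) = R₁ ^ (-ε) * p ^ (n + 1) := by
        rw [Real.div_rpow hR₁.le (by positivity), Real.rpow_neg (by positivity : 0 ≤ q ^ (n + 1)),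
          div_inv_eq_mul, ← Real.rpow_natCast, ← Real.rpow_mul hq.le, mul_comm (((n + 1 : ℕ) : ℝ)),
          Real.rpow_mul hq.le, Real.rpow_natCast]
      have h1 := hstep _ hge
      rw [e1, e2] at h1
      have h2 : K * (1 - p ^ n) + B * (R₁ ^ (-ε) * p ^ (n + 1)) ≤ K * (1 - p ^ (n + 1)) := by
        have e3 : B * R₁ ^ (-ε) = K * (1 - p) := by rw [hK, div_mul_cancel₀ _ h1p.ne']
        rw [← mul_assoc, e3, pow_succ]
        have : 0 ≤ K * p ^ n * (1 - p) * (1 - p) := by positivity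
        nlinarith
      calc _ ≤ _ := h1
        _ ≤ v R₁ * Real.exp (K * (1 - p ^ n)) * Real.exp (B * (R₁ ^ (-ε) * p ^ (n + 1))) := by
            gcongr
        _ = v R₁ * Real.exp (K * (1 - p ^ n) + B * (R₁ ^ (-ε) * p ^ (n + 1))) := by
            rw [mul_assoc, ← Real.exp_add]
        _ ≤ _ := by
            have := hv R₁
            gcongr
  refine ⟨v R₁ * Real.exp K, frequently_atTop.2 fun a => ?_⟩
  have htend : Tendsto (fun n : ℕ => R₁ / q ^ n) atTop atTop := by
    have := (tendsto_pow_atTop_atTop_of_one_lt ((one_lt_inv₀ hq).2 hq1)).const_mul_atTop hR₁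
    refine this.congr fun n => ?_
    rw [inv_pow, div_eq_mul_inv]
  obtain ⟨n, hn⟩ := (htend.eventually_ge_atTop a).exists
  refine ⟨_, hn, (hbound n).trans ?_⟩
  have := hv R₁
  gcongr
  have : 0 ≤ K * p ^ n := by positivity
  linarith

namespace TractBounds

variable {Ω : Set ℂ} {τ φ : ℂ → ℂ} {M m α R₀ : ℝ}

theorem norm_sub_le_segMean (hb : TractBounds φ M m α R₀) (h : IsTractModel Ω τ φ) {R : ℝ}
    (hR : R₀ ≤ R) {a b : ℝ} (hab : a ≤ b) :
    ‖φ (1 + ((R * b : ℝ) : ℂ) * Complex.I) - φ (1 + ((R * a : ℝ) : ℂ) * Complex.I)‖ ≤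
      diamTract φ R * segMean φ R 1 a b := by
  have hR0 : 0 < R := by linarith [hb.one_lt]
  have hd := hb.diam_pos hR
  have hderiv : ∀ y : ℝ, HasDerivAt (fun y : ℝ => φ (1 + ((R * y : ℝ) : ℂ) * Complex.I))
      (deriv φ (1 + ((R * y : ℝ) : ℂ) * Complex.I) * ((R : ℂ) * Complex.I)) y := by
    intro y
    have h1 : HasDerivAt (fun y : ℝ => 1 + ((R * y : ℝ) : ℂ) * Complex.I)
        ((R : ℂ) * Complex.I) y := by
      have h2 : HasDerivAt (fun y : ℝ => R * y) R y := by
        simpa using (hasDerivAt_id y).const_mul R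
      exact (h2.ofReal_comp.mul_const Complex.I).const_add 1
    exact (h.hasDerivAt (one_add_mem _)).comp y h1
  have hcont : Continuous fun y : ℝ =>
      deriv φ (1 + ((R * y : ℝ) : ℂ) * Complex.I) * ((R : ℂ) * Complex.I) :=
    (h.differentiableOn_deriv.continuousOn.comp_continuous (by fun_prop)
      fun y => one_add_mem _).mul continuous_const
  rw [← intervalIntegral.integral_eq_sub_of_hasDerivAt (fun y _ => hderiv y)
    (hcont.intervalIntegrable _ _), h.segMean_eq hR0, ← intervalIntegral.integral_const_mul]
  refine (intervalIntegral.norm_integral_le_integral_norm hab).trans (le_of_eq ?_)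
  refine intervalIntegral.integral_congr fun y _ => ?_
  simp only [Real.rpow_one, gSpeed]
  rw [norm_mul, norm_mul, Complex.norm_I, mul_one, Complex.norm_real, Real.norm_eq_abs,
    abs_of_pos hR0]
  field_simp

theorem tendsto_norm_vertical (h : IsTractModel Ω τ φ) :
    Tendsto (fun R : ℝ => ‖φ (1 + (R : ℂ) * Complex.I)‖) atTop atTop := by
  have h1 : Tendsto (fun R : ℝ => 1 + (R : ℂ) * Complex.I) atTop
      (Bornology.cobounded ℂ ⊓ 𝓟 rightHalfPlane) := by
    refine tendsto_inf.2 ⟨?_, tendsto_principal.2 (Eventually.of_forall one_add_mem)⟩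
    rw [← tendsto_norm_atTop_iff_cobounded]
    refine tendsto_atTop_mono (fun R => ?_) tendsto_id
    have := (le_abs_self _).trans (Complex.abs_im_le_norm (1 + (R : ℂ) * Complex.I))
    simpa using this
  exact tendsto_norm_atTop_iff_cobounded.2 (h.proper.comp h1)

/-- For t = 1 the mean bounds the displacement of φ between 1 + iκR and 1 + iR, relative to diam
Ω_R. If β_∞(1) < 0, this displacement is O(R^{-ε}) relative to |φ(1 + iR)|, because |φ| is
comparable to the diameter there. Then |φ| grows by summable factors along R₁/κ^n and stays bounded,
contradicting properness. -/
theorem beta_one_nonneg (hb : TractBounds φ M m α R₀) (h : IsTractModel Ω τ φ) {x : ℝ}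
    (hx : betaInf φ 1 = x) : 0 ≤ x := by
  by_contra hneg
  push Not at hneg
  set ε := -x / 2 with hε
  have hε0 : 0 < ε := by rw [hε]; linarith
  have hM := hb.one_le_M
  have hm := hb.m_pos
  have hκ := kappa_pos
  have hκ1 := kappa_lt_one
  have h1 : ∀ᶠ R in atTop, (betaR φ R 1 : EReal) < ((-ε : ℝ) : EReal) := by
    have hlt : limsup (fun R => (betaR φ R 1 : EReal)) atTop < ((-ε : ℝ) : EReal) := by
      change betaInf φ 1 < _
      rw [hx]
      exact_mod_cast (by rw [hε]; linarith : x < -ε)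
    exact eventually_lt_of_limsup_lt hlt
  have hsmall : ∀ᶠ R : ℝ in atTop, M / m * R ^ (-ε) < 1 / 2 := by
    have := (tendsto_rpow_neg_atTop hε0).const_mul (M / m)
    rw [mul_zero] at this
    exact this.eventually (gt_mem_nhds (by norm_num))
  obtain ⟨R₁, hR₁⟩ := eventually_atTop.1 (h1.and (hsmall.and (eventually_ge_atTop R₀)))
  have hstep : ∀ R, max R₁ 1 ≤ R → ‖φ (1 + (R : ℂ) * Complex.I)‖ ≤
      ‖φ (1 + ((kappa * R : ℝ) : ℂ) * Complex.I)‖ * Real.exp (2 * (M / m) * R ^ (-ε)) := by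
    intro R hR
    obtain ⟨h2, h3, h4⟩ := hR₁ R ((le_max_left _ _).trans hR)
    have hR1 : 1 < R := hb.one_lt.trans_le h4
    have hR0 : 0 < R := by linarith
    have hlog := Real.log_pos hR1
    have hd := hb.diam_pos h4
    have hs := hb.scale_pos R h4
    have h5 : segMean φ R 1 kappa 1 ≤ R ^ (-ε) := by
      refine (le_max_right _ _ : _ ≤ meanI φ R 1).trans ?_
      have h2' : betaR φ R 1 < -ε := by exact_mod_cast h2
      rw [betaR, div_lt_iff₀ hlog, ← Real.log_rpow hR0] at h2'
      by_contra hcon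
      push Not at hcon
      exact absurd (Real.log_le_log (by positivity) hcon.le) (not_le.2 h2')
    have h6 := hb.norm_sub_le_segMean h h4 hκ1.le
    rw [mul_one, mul_comm R kappa] at h6
    have hQ : (1 + (R : ℂ) * Complex.I) ∈ Q (2 * R) := by
      refine ⟨?_, ?_, ?_, ?_⟩ <;> simp <;> linarith
    have h7 := hb.le_norm R h4 _ hQ (by
      simp only [Complex.add_im, Complex.one_im, Complex.mul_im, Complex.ofReal_re, Complex.I_im,
        Complex.ofReal_im, Complex.I_re]
      rw [mul_zero, mul_one, add_zero, zero_add, abs_of_pos hR0]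
      nlinarith)
    set V := ‖φ (1 + (R : ℂ) * Complex.I)‖ with hV
    set W := ‖φ (1 + ((kappa * R : ℝ) : ℂ) * Complex.I)‖ with hW
    set y := M / m * R ^ (-ε) with hy
    have hy0 : 0 ≤ y := by positivity
    have hV0 : 0 ≤ V := norm_nonneg _
    have hW0 : 0 ≤ W := norm_nonneg _
    have h8 : V - W ≤ y * V := by
      calc V - W ≤ _ := norm_sub_norm_le _ _
        _ ≤ diamTract φ R * segMean φ R 1 kappa 1 := h6
        _ ≤ diamTract φ R * R ^ (-ε) := by gcongr
        _ ≤ (M * tractScale φ R) * R ^ (-ε) := by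
            have := hb.diam_le R h4
            gcongr
        _ = M / m * R ^ (-ε) * (m * tractScale φ R) := by field_simp
        _ ≤ y * V := by gcongr
    have h9 : 1 + 2 * y ≤ Real.exp (2 * (M / m) * R ^ (-ε)) := by
      have := Real.add_one_le_exp (2 * y)
      rw [mul_assoc, ← hy]
      linarith
    -- From V(1 - y) ≤ W and (1 - y)(1 + 2y) ≥ 1, valid for 0 ≤ y ≤ 1/2.
    have h10 : V ≤ W * (1 + 2 * y) := by
      have h11 : V * (1 - y) ≤ W := by linarith
      have h12 := mul_le_mul_of_nonneg_right h11 (by linarith : 0 ≤ 1 + 2 * y)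
      nlinarith [mul_nonneg hV0 (mul_nonneg hy0 (by linarith : 0 ≤ 1 - 2 * y))]
    exact h10.trans (by gcongr)
  obtain ⟨A, hA⟩ := exists_frequently_le_of_le_mul_exp
    (v := fun R => ‖φ (1 + (R : ℂ) * Complex.I)‖) hκ hκ1 (by positivity) hε0
    (by positivity : 0 < max R₁ 1) (fun _ => norm_nonneg _) hstep
  obtain ⟨R, hR, hR'⟩ :=
    (hA.and_eventually ((tendsto_norm_vertical h).eventually_gt_atTop A)).exists
  linarith

end TractBounds
end HolderTract

/-! ### Inverse branches of λe^τ near a point of modulus comparable to P -/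

namespace HolderTract

/-- A logarithm of `w / lam` on a disk around `C`. -/
noncomputable def logBranch (lam : ℝ) (C w : ℂ) : ℂ :=
  Complex.log (C / lam) + Complex.log (w / C)

section logBranch

variable {lam : ℝ} {C w : ℂ}

theorem div_mem_slitPlane (hC : C ≠ 0) (hw : ‖w - C‖ < ‖C‖) : w / C ∈ Complex.slitPlane := by
  have h0 : 0 < ‖C‖ := norm_pos_iff.2 hC
  have h1 : ‖w / C - 1‖ < 1 := by
    rw [div_sub_one hC, norm_div, div_lt_one h0]
    exact hw
  have h2 := (abs_lt.1 ((Complex.abs_re_le_norm _).trans_lt h1)).1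
  rw [Complex.sub_re, Complex.one_re] at h2
  exact Or.inl (by linarith)

theorem mul_exp_logBranch (hl : 0 < lam) (hC : C ≠ 0) (hw : w ≠ 0) :
    (lam : ℂ) * Complex.exp (logBranch lam C w) = w := by
  have hl' : (lam : ℂ) ≠ 0 := Complex.ofReal_ne_zero.2 hl.ne'
  rw [logBranch, Complex.exp_add, Complex.exp_log (div_ne_zero hC hl'),
    Complex.exp_log (div_ne_zero hw hC)]
  field_simp

theorem hasDerivAt_logBranch (hC : C ≠ 0) (hw : ‖w - C‖ < ‖C‖) :
    HasDerivAt (logBranch lam C) (1 / w) w := by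
  have hs := div_mem_slitPlane hC hw
  have hw0 : w ≠ 0 := by
    rintro rfl
    rw [zero_sub, norm_neg] at hw
    exact lt_irrefl _ hw
  have h1 := (((hasDerivAt_id w).div_const C).clog hs).const_add (Complex.log (C / lam))
  refine h1.congr_deriv ?_
  simp only [id]
  field_simp

theorem logBranch_re (hl : 0 < lam) (hC : C ≠ 0) (hw : w ≠ 0) :
    (logBranch lam C w).re = Real.log ‖w‖ - Real.log lam := by
  have hC0 := norm_ne_zero_iff.2 hC
  have hw0 := norm_ne_zero_iff.2 hw
  rw [logBranch, Complex.add_re, Complex.log_re, Complex.log_re, norm_div, norm_div,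
    Complex.norm_real, Real.norm_eq_abs, abs_of_pos hl, Real.log_div hC0 hl.ne', Real.log_div hw0 hC0]
  ring

theorem abs_logBranch_im_le (lam : ℝ) (C w : ℂ) : |(logBranch lam C w).im| ≤ 2 * Real.pi := by
  rw [logBranch, Complex.add_im, Complex.log_im, Complex.log_im]
  have h1 := Complex.abs_arg_le_pi (C / lam)
  have h2 := Complex.abs_arg_le_pi (w / C)
  exact (abs_add_le _ _).trans (by linarith)

end logBranch

theorem norm_exp_sub_exp_le {a b : ℂ} {B : ℝ} (ha : a.re ≤ B) (hb : b.re ≤ B) :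
    ‖Complex.exp a - Complex.exp b‖ ≤ Real.exp B * ‖a - b‖ := by
  have hconv : Convex ℝ {z : ℂ | z.re ≤ B} := convex_halfSpace_re_le B
  refine hconv.norm_image_sub_le_of_norm_hasDerivWithin_le
    (fun z _ => (Complex.hasDerivAt_exp z).hasDerivWithinAt) (fun z hz => ?_) hb ha
  rw [Complex.norm_exp]
  exact Real.exp_le_exp.2 hz

/-- The point at height `log P + 2πik`, near which the logarithms of points of modulus
comparable to `P` lie. -/
noncomputable def gridPoint (P : ℝ) (k : ℤ) : ℂ := ⟨Real.log P, 2 * Real.pi * k⟩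

/-- The inverse branches of `lam * exp τ`. -/
noncomputable def tractBranch (φ : ℂ → ℂ) (lam : ℝ) (C : ℂ) (k : ℤ) (w : ℂ) : ℂ :=
  φ (logBranch lam C w + k * (2 * Real.pi * Complex.I))

namespace TractBounds

variable {Ω : Set ℂ} {τ φ f : ℂ → ℂ} {M m α R₀ lam : ℝ}

/-- Logarithms of points in B(C, mP/4) lie within a constant K of the grid points, while the Hölder
estimate works at scale R; the factor (K/R)^α gives invariance of the disc. Contraction comes from
the derivative φ'(L)/w, with |φ'(L)| = O(P R^{-α}) and |w| ≥ mP/2. -/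
theorem eventually_isBranchSystem (hb : TractBounds φ M m α R₀) (h : IsTractModel Ω τ φ)
    (hl : 0 < lam) (hf : ∀ z ∈ Ω, f z = lam * Complex.exp (τ z)) :
    ∃ c > 0, ∀ᶠ R in atTop, ∀ (S : Finset ℤ) (C : ℂ), S.Nonempty →
      m * tractScale φ R ≤ ‖C‖ → ‖C‖ ≤ M * tractScale φ R →
      (∀ k ∈ S, |2 * Real.pi * k| ≤ R + Real.pi) →
      (∀ k ∈ S, ‖φ (gridPoint (tractScale φ R) k) - C‖ ≤ m * tractScale φ R / 8) →
      IsBranchSystem f Ω S (tractBranch φ lam C) C (m * tractScale φ R / 4)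
        (3 / 16 * m * tractScale φ R) ∧
      ∀ k ∈ S, ∀ x ∈ Metric.ball C (m * tractScale φ R / 4),
        ∀ y ∈ Metric.ball C (m * tractScale φ R / 4),
        c * (‖deriv φ (gridPoint (tractScale φ R) k)‖ / tractScale φ R) * ‖x - y‖ ≤
          ‖tractBranch φ lam C k x - tractBranch φ lam C k y‖ := by
  have hM := hb.one_le_M
  have hm := hb.m_pos
  have hα := hb.alpha_pos
  have hπ := Real.pi_pos
  have hπ4 := Real.pi_le_four
  -- K₁ bounds |Re log(w/λ) - log P| when mP/2 ≤ |w| ≤ 2MP; K adds 2π for the imaginary part.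
  set K₁ := |Real.log (m / 2)| + |Real.log (2 * M)| + |Real.log lam| with hK₁
  set K := K₁ + 2 * Real.pi + 1 with hK
  have hK₁0 : 0 ≤ K₁ := by positivity
  have hK0 : 0 < K := by positivity
  set E := Real.exp (10000 * (Real.log 2 + 2 * Real.pi)) with hE
  have hE0 : 0 < E := Real.exp_pos _
  have hlog2 : 0 ≤ Real.log 2 := Real.log_nonneg (by norm_num)
  -- 384 is the Koebe constant, E compares φ' at the grid point and at the logarithm, and 2M comes
  -- from |x - y| ≤ 2MP |L(x) - L(y)|.
  refine ⟨(384 * E * (2 * M))⁻¹, by positivity, ?_⟩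
  have e1 : ∀ᶠ R in atTop, 4 * K ≤ Real.log (tractScale φ R) :=
    (Real.tendsto_log_atTop.comp hb.tendsto).eventually_ge_atTop _
  -- Since P ≤ R^{10002}, this gives log P ≤ R/2, which places the grid points and logarithms in
  -- Q_{2R}.
  have e2 : ∀ᶠ R : ℝ in atTop, 10002 * Real.log R ≤ 1 / 2 * R := by
    have := Real.isLittleO_log_id_atTop.bound (c := 1 / 20004) (by norm_num)
    filter_upwards [this, eventually_ge_atTop 1] with R h1 h2
    rw [Real.norm_eq_abs, Real.norm_eq_abs, id, abs_of_nonneg (by linarith : 0 ≤ R)] at h1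
    linarith [le_abs_self (Real.log R)]
  have e3 : ∀ᶠ R : ℝ in atTop, M * (K / R) ^ α ≤ m / 16 := by
    have h1 : Tendsto (fun R : ℝ => M * (K / R) ^ α) atTop (𝓝 (M * 0 ^ α)) :=
      ((tendsto_const_nhds.div_atTop tendsto_id).rpow_const (Or.inr hα.le)).const_mul M
    rw [Real.zero_rpow hα.ne', mul_zero] at h1
    exact h1.eventually (ge_mem_nhds (by positivity))
  have e4 : ∀ᶠ R : ℝ in atTop, 2 * M * (1 / R) ^ α ≤ m / 4 := by
    have h1 : Tendsto (fun R : ℝ => 2 * M * (1 / R) ^ α) atTop (𝓝 (2 * M * 0 ^ α)) :=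
      ((tendsto_const_nhds.div_atTop tendsto_id).rpow_const (Or.inr hα.le)).const_mul _
    rw [Real.zero_rpow hα.ne', mul_zero] at h1
    exact h1.eventually (ge_mem_nhds (by positivity))
  filter_upwards [e1, e2, e3, e4, eventually_ge_atTop (2 * K), eventually_ge_atTop R₀,
    eventually_ge_atTop 30] with R h1 h2 h3 h4 h5 hR hR30 S C hS hC1 hC2 hSR hSC
  have hR0 : 0 < R := by linarith
  have hP := hb.scale_pos R hR
  have hPR := hb.scale_le R hR
  set P := tractScale φ R with hPdef
  set X := Real.log P with hX
  have hXR : X ≤ 1 / 2 * R := by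
    have := Real.log_le_log hP hPR
    rw [Real.log_rpow hR0] at this
    linarith
  have hmP : 0 < m * P := by positivity
  have hC0 : C ≠ 0 := norm_pos_iff.1 (hmP.trans_le hC1)
  have hmM : m ≤ M := le_of_mul_le_mul_right (hC1.trans hC2) hP
  have hwlt : ∀ w ∈ Metric.ball C (m * P / 4), ‖w - C‖ < ‖C‖ := fun w hw => by
    rw [mem_ball_iff_norm] at hw; linarith
  have hwlow : ∀ w ∈ Metric.ball C (m * P / 4), m / 2 * P ≤ ‖w‖ := fun w hw => by
    rw [mem_ball_iff_norm'] at hw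
    have := norm_sub_norm_le C w
    linarith
  have hwup : ∀ w ∈ Metric.ball C (m * P / 4), ‖w‖ ≤ 2 * M * P := fun w hw => by
    rw [mem_ball_iff_norm] at hw
    have := norm_sub_norm_le w C
    nlinarith
  have hw0 : ∀ w ∈ Metric.ball C (m * P / 4), w ≠ 0 := fun w hw =>
    norm_pos_iff.1 (lt_of_lt_of_le (by positivity) (hwlow w hw))
  have hre : ∀ w ∈ Metric.ball C (m * P / 4), |(logBranch lam C w).re - X| ≤ K₁ := by
    intro w hw
    rw [logBranch_re hl hC0 (hw0 w hw)]
    have a1 := Real.log_le_log (by positivity) (hwlow w hw)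
    have a2 := Real.log_le_log (norm_pos_iff.2 (hw0 w hw)) (hwup w hw)
    rw [Real.log_mul (by positivity) hP.ne'] at a1 a2
    have b1 := abs_le.1 (le_refl |Real.log (m / 2)|)
    have b2 := abs_le.1 (le_refl |Real.log (2 * M)|)
    have b3 := abs_le.1 (le_refl |Real.log lam|)
    have c1 := abs_nonneg (Real.log (m / 2))
    have c2 := abs_nonneg (Real.log (2 * M))
    rw [abs_le, hK₁]
    constructor <;> linarith
  set L : ℤ → ℂ → ℂ := fun k w => logBranch lam C w + k * (2 * Real.pi * Complex.I) with hL
  have hLre : ∀ k w, (L k w).re = (logBranch lam C w).re := by intro k w; simp [hL]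
  have hLim : ∀ k w, (L k w).im = (logBranch lam C w).im + 2 * Real.pi * k := by
    intro k w; simp [hL]; ring
  have hψ : ∀ k w, tractBranch φ lam C k w = φ (L k w) := fun k w => rfl
  have hgre : ∀ k, (gridPoint P k).re = X := fun k => rfl
  have hgim : ∀ k, (gridPoint P k).im = 2 * Real.pi * k := fun k => rfl
  have hXb : ∀ k, ∀ w ∈ Metric.ball C (m * P / 4), X - K₁ ≤ (L k w).re ∧ (L k w).re ≤ X + K₁ := by
    intro k w hw
    have := abs_le.1 (hre w hw)
    rw [hLre]
    constructor <;> linarith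
  have hLm : ∀ k, ∀ w ∈ Metric.ball C (m * P / 4), L k w ∈ rightHalfPlane := by
    intro k w hw
    have := (hXb k w hw).1
    change 0 < (L k w).re
    linarith
  have hLQ : ∀ k ∈ S, ∀ w ∈ Metric.ball C (m * P / 4), |(L k w).im| ≤ 3 / 2 * R := by
    intro k hk w _
    rw [hLim]
    have a1 := abs_logBranch_im_le lam C w
    have a2 := hSR k hk
    exact (abs_add_le _ _).trans (by linarith)
  have hdist : ∀ k, ∀ w ∈ Metric.ball C (m * P / 4), ‖L k w - gridPoint P k‖ ≤ K := by
    intro k w hw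
    refine (Complex.norm_le_abs_re_add_abs_im _).trans ?_
    rw [Complex.sub_re, Complex.sub_im, hgre, hgim, hLre, hLim, add_sub_cancel_right]
    linarith [hre w hw, abs_logBranch_im_le lam C w]
  have hderiv : ∀ k, ∀ w ∈ Metric.ball C (m * P / 4),
      HasDerivAt (tractBranch φ lam C k) (deriv φ (L k w) * (1 / w)) w := by
    intro k w hw
    exact (h.hasDerivAt (hLm k w hw)).comp w
      ((hasDerivAt_logBranch hC0 (hwlt w hw)).add_const _)
  constructor
  · refine ⟨by nlinarith, h.isOpen, ?_, hS, ?_, fun k _ w hw => h.mapsTo_inv (hLm k w hw),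
      fun k _ w hw => (hderiv k w hw).differentiableAt.differentiableWithinAt, ?_, ?_, ?_,
      Metric.mem_ball_self (by positivity)⟩
    · have hd : DifferentiableOn ℂ (fun z => (lam : ℂ) * Complex.exp (τ z)) Ω :=
        (h.holo.cexp).const_mul _
      exact hd.congr hf
    · intro k hk w hw
      rw [mem_closedBall_iff_norm]
      have hq1 : L k w ∈ Q (2 * R) := by
        have a1 := hXb k w hw
        have a2 := abs_le.1 (hLQ k hk w hw)
        exact ⟨by linarith, by linarith, by linarith, by linarith⟩
      have hq2 : gridPoint P k ∈ Q (2 * R) := by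
        have a2 := abs_le.1 (hSR k hk)
        refine ⟨?_, ?_, ?_, ?_⟩
        · rw [hgre]; linarith
        · rw [hgre]; linarith
        · rw [hgim]; linarith
        · rw [hgim]; linarith
      have a3 := hb.holder R hR _ hq1 _ hq2
      -- This mP/16 together with the mP/8 of the hypothesis gives the inner radius 3mP/16 < mP/4.
      have a4 : ‖φ (L k w) - φ (gridPoint P k)‖ ≤ m * P / 16 := by
        calc _ ≤ _ := a3
          _ ≤ M * P * (K / R) ^ α := by
              gcongr
              exact hdist k w hw
          _ = M * (K / R) ^ α * P := by ring
          _ ≤ m / 16 * P := by gcongr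
          _ = _ := by ring
      have a5 := norm_sub_le_norm_sub_add_norm_sub (φ (L k w)) (φ (gridPoint P k)) C
      have a6 := hSC k hk
      rw [hψ]
      linarith
    · intro k _ w hw
      rw [hψ, hf _ (h.mapsTo_inv (hLm k w hw)), h.right_inv _ (hLm k w hw), hL]
      simp only
      rw [Complex.exp_periodic.int_mul k, mul_exp_logBranch hl hC0 (hw0 w hw)]
    · intro j _ k _ hjk w hw heq
      rw [hψ, hψ] at heq
      have a1 := congrArg Complex.im (h.injOn (hLm j w hw) (hLm k w hw) heq)
      rw [hLim, hLim] at a1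
      have a2 := mul_left_cancel₀ (by positivity : 2 * Real.pi ≠ 0) (add_left_cancel a1)
      exact hjk (by exact_mod_cast a2)
    · intro k hk w hw
      have a1 := hXb k w hw
      have a2 := hb.norm_deriv_le h hR (z := L k w) (by linarith) (by linarith) (hLQ k hk w hw)
      have a3 := hwlow w hw
      rw [(hderiv k w hw).deriv, norm_mul, norm_div, norm_one, mul_one_div,
        div_le_iff₀ (norm_pos_iff.2 (hw0 w hw))]
      calc _ ≤ _ := a2
        _ = 2 * M * (1 / R) ^ α * P := by ring
        _ ≤ m / 4 * P := by gcongr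
        _ ≤ _ := by linarith
  · intro k hk x hx y hy
    rw [hψ, hψ]
    have a1 := hXb k x hx
    have a2 := hXb k y hy
    -- Both points are within K of the grid point, and log P ≥ 4K leaves a real part of at least 2K.
    have hxy : ‖L k x - L k y‖ ≤ (L k x).re := by
      have b1 := hdist k x hx
      have b2 := hdist k y hy
      rw [norm_sub_rev] at b2
      have := norm_sub_le_norm_sub_add_norm_sub (L k x) (gridPoint P k) (L k y)
      linarith
    have a3 := h.mul_norm_deriv_mul_norm_sub_le (hLm k y hy) hxy
    have a4 : ‖x - y‖ ≤ 2 * M * P * ‖L k x - L k y‖ := by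
      have b0 : L k x - L k y = logBranch lam C x - logBranch lam C y := by
        simp only [hL]; ring
      have b1 : ∀ w ∈ Metric.ball C (m * P / 4),
          (logBranch lam C w).re ≤ Real.log (2 * M * P) - Real.log lam := by
        intro w hw
        rw [logBranch_re hl hC0 (hw0 w hw)]
        linarith [Real.log_le_log (norm_pos_iff.2 (hw0 w hw)) (hwup w hw)]
      have b2 := norm_exp_sub_exp_le (b1 x hx) (b1 y hy)
      rw [Real.exp_sub, Real.exp_log (by positivity), Real.exp_log hl] at b2
      rw [b0]
      nth_rw 1 [← mul_exp_logBranch hl hC0 (hw0 x hx), ← mul_exp_logBranch hl hC0 (hw0 y hy)]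
      rw [← mul_sub, norm_mul, Complex.norm_real, Real.norm_eq_abs, abs_of_pos hl]
      calc _ ≤ lam * (2 * M * P / lam * ‖logBranch lam C x - logBranch lam C y‖) := by gcongr
        _ = _ := by field_simp
    have hgm : gridPoint P k ∈ rightHalfPlane := by
      change 0 < (gridPoint P k).re
      rw [hgre]; linarith
    have a5 : ‖deriv φ (gridPoint P k)‖ ≤ ‖deriv φ (L k x)‖ * E := by
      refine (h.norm_deriv_le (hLm k x hx) hgm).trans ?_
      rw [hgre, hgim, hLim]
      have hXpos : 1 ≤ X := by linarith
      have hLpos : 0 < (L k x).re := hLm k x hx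
      have c1 : |Real.log (X / (L k x).re)| ≤ Real.log 2 := by
        rw [abs_le]
        constructor
        · rw [← Real.log_inv]
          apply Real.log_le_log (by norm_num)
          rw [le_div_iff₀ hLpos]
          linarith
        · apply Real.log_le_log (by positivity)
          rw [div_le_iff₀ hLpos]
          linarith
      have c2 : |2 * Real.pi * k - ((logBranch lam C x).im + 2 * Real.pi * k)| / X ≤
          2 * Real.pi := by
        have := abs_logBranch_im_le lam C x
        rw [show 2 * Real.pi * (k : ℝ) - ((logBranch lam C x).im + 2 * Real.pi * k) =
          -(logBranch lam C x).im by ring, abs_neg, div_le_iff₀ (by linarith)]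
        nlinarith
      gcongr
      rw [hE]
      gcongr
    calc (384 * E * (2 * M))⁻¹ * (‖deriv φ (gridPoint P k)‖ / P) * ‖x - y‖
        ≤ (384 * E * (2 * M))⁻¹ * (‖deriv φ (L k x)‖ * E / P) * (2 * M * P * ‖L k x - L k y‖) := by
          gcongr
      _ = ‖deriv φ (L k x)‖ * ‖L k x - L k y‖ / 384 := by field_simp
      _ ≤ _ := by linarith

end TractBounds
end HolderTract

/-! ### From integral means to grid sums and repellers -/

namespace HolderTract

open MeasureTheory in
theorem intervalIntegral_indicator_Icc_le {a b c d B : ℝ} (hab : a ≤ b) (hcd : c ≤ d) (hB : 0 ≤ B) :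
    IntervalIntegrable ((Icc c d).indicator fun _ => B) volume a b ∧
      ∫ y in a..b, (Icc c d).indicator (fun _ => B) y ≤ (d - c) * B := by
  constructor
  · rw [intervalIntegrable_iff_integrableOn_Ioc_of_le hab]
    exact (integrableOn_const (by simp) (by simp)).indicator measurableSet_Icc
  · rw [intervalIntegral.integral_of_le hab, integral_indicator_const _ measurableSet_Icc,
      smul_eq_mul, measureReal_restrict_apply measurableSet_Icc]
    gcongr
    calc volume.real (Icc c d ∩ Ioc a b) ≤ volume.real (Icc c d) :=
          measureReal_mono inter_subset_left (by simp)
      _ = d - c := Real.volume_real_Icc_of_le hcd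

namespace TractBounds

variable {Ω : Set ℂ} {τ φ f : ℂ → ℂ} {M m α R₀ lam : ℝ}

/-- Comparison of the integral means with sums over the grid points. -/
theorem segMean_le_sum (hb : TractBounds φ M m α R₀) (h : IsTractModel Ω τ φ) {R : ℝ}
    (hR : R₀ ≤ R) (hX : 1 ≤ Real.log (tractScale φ R)) {a b t : ℝ} (hab : a ≤ b) (ha : -1 ≤ a)
    (hb1 : b ≤ 1) (hκ : ∀ y ∈ Icc a b, kappa ≤ |y|) (ht : 0 ≤ t) :
    ∃ S : Finset ℤ, (∀ k ∈ S, kappa * R - Real.pi ≤ |2 * Real.pi * k| ∧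
        |2 * Real.pi * k| ≤ R + Real.pi) ∧
      segMean φ R t a b ≤ 2 * Real.pi / R * (2 * R * (Real.log (tractScale φ R) ^ (10000 : ℝ) *
        Real.exp (10000 * Real.pi))) ^ t *
        ∑ k ∈ S, (‖deriv φ (gridPoint (tractScale φ R) k)‖ / tractScale φ R) ^ t := by
  have hR0 : 0 < R := by linarith [hb.one_lt]
  have hP := hb.scale_pos R hR
  have hd := hb.diam_pos hR
  have hle := hb.le_diam R hR
  have hπ := Real.pi_pos
  have hπ3 := Real.pi_gt_three
  set P := tractScale φ R with hPdef
  set X := Real.log P with hXdef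
  set S : Finset ℤ := (Finset.Icc ⌈-(R + Real.pi)⌉ ⌊R + Real.pi⌋).filter fun k =>
    kappa * R - Real.pi ≤ |2 * Real.pi * k| ∧ |2 * Real.pi * k| ≤ R + Real.pi with hS
  refine ⟨S, fun k hk => (Finset.mem_filter.1 hk).2, ?_⟩
  set W := 2 * R * (X ^ (10000 : ℝ) * Real.exp (10000 * Real.pi)) with hW
  have hW0 : 0 ≤ W := by positivity
  set A : ℤ → ℝ := fun k => ‖deriv φ (gridPoint P k)‖ / P with hA
  have hA0 : ∀ k, 0 ≤ A k := fun k => by positivity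
  -- Interval of length 2π/R around the height of grid point k, in the rescaled variable.
  set I : ℤ → Set ℝ := fun k => Icc ((2 * Real.pi * k - Real.pi) / R)
    ((2 * Real.pi * k + Real.pi) / R) with hI
  have hcd : ∀ k : ℤ, (2 * Real.pi * k - Real.pi) / R ≤ (2 * Real.pi * k + Real.pi) / R :=
    fun k => by gcongr; linarith
  have hB : ∀ k, 0 ≤ W ^ t * A k ^ t := fun k => by positivity
  have hpt : ∀ y ∈ Icc a b, gSpeed φ R y ^ t ≤
      ∑ k ∈ S, (I k).indicator (fun _ => W ^ t * A k ^ t) y := by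
    intro y hy
    set k := round (R * y / (2 * Real.pi)) with hk
    have h1 : |R * y - 2 * Real.pi * k| ≤ Real.pi := by
      have h2 := abs_sub_round (R * y / (2 * Real.pi))
      rw [← hk] at h2
      have e : R * y - 2 * Real.pi * k = 2 * Real.pi * (R * y / (2 * Real.pi) - k) := by
        field_simp
      rw [e, abs_mul, abs_of_pos (by positivity)]
      nlinarith
    have hyR : |R * y| = R * |y| := by rw [abs_mul, abs_of_pos hR0]
    have hy1 : |y| ≤ 1 := abs_le.2 ⟨by linarith [hy.1], by linarith [hy.2]⟩
    have h2 : |2 * Real.pi * k| ≤ R + Real.pi := by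
      have := abs_sub_abs_le_abs_sub (2 * Real.pi * (k : ℝ)) (R * y)
      rw [abs_sub_comm] at this
      nlinarith
    have h3 : kappa * R - Real.pi ≤ |2 * Real.pi * k| := by
      have := abs_sub_abs_le_abs_sub (R * y) (2 * Real.pi * (k : ℝ))
      nlinarith [hκ y hy]
    have hkS : k ∈ S := by
      rw [hS, Finset.mem_filter, Finset.mem_Icc, Int.ceil_le, Int.le_floor]
      refine ⟨?_, h3, h2⟩
      rw [abs_mul, abs_of_pos (by positivity)] at h2
      have h4 : |(k : ℝ)| ≤ R + Real.pi := by
        nlinarith [abs_nonneg (k : ℝ)]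
      exact abs_le.1 h4
    have hyI : y ∈ I k := by
      obtain ⟨h4, h5⟩ := abs_le.1 h1
      exact ⟨by rw [div_le_iff₀ hR0]; linarith, by rw [le_div_iff₀ hR0]; linarith⟩
    have h5 : gSpeed φ R y ^ t ≤ (I k).indicator (fun _ => W ^ t * A k ^ t) y := by
      rw [indicator_of_mem hyI, ← Real.mul_rpow hW0 (hA0 k)]
      refine Real.rpow_le_rpow (by unfold gSpeed; positivity) ?_ ht
      have hgm : gridPoint P k ∈ rightHalfPlane := by
        change 0 < X
        linarith
      -- Descent from real part log P to real part 1, at vertical distance at most π: only a power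
      -- of log P is lost.
      have h6 := h.norm_deriv_le hgm (one_add_mem (R * y))
      have e1 : (1 + ((R * y : ℝ) : ℂ) * Complex.I).re = 1 := by simp
      have e2 : (1 + ((R * y : ℝ) : ℂ) * Complex.I).im = R * y := by simp
      have e3 : (gridPoint P k).re = X := rfl
      have e4 : (gridPoint P k).im = 2 * Real.pi * k := rfl
      rw [e1, e2, e3, e4, div_one, one_div, Real.log_inv, abs_neg,
        abs_of_nonneg (Real.log_nonneg hX)] at h6
      have h7 : Real.exp (10000 * (Real.log X + |R * y - 2 * Real.pi * k|)) ≤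
          X ^ (10000 : ℝ) * Real.exp (10000 * Real.pi) := by
        rw [Real.rpow_def_of_pos (by linarith), ← Real.exp_add, Real.exp_le_exp]
        linarith
      unfold gSpeed
      rw [div_le_iff₀ hd]
      calc R * ‖deriv φ (1 + ((R * y : ℝ) : ℂ) * Complex.I)‖
          ≤ R * (‖deriv φ (gridPoint P k)‖ * (X ^ (10000 : ℝ) * Real.exp (10000 * Real.pi))) := by
            gcongr
            exact h6.trans (by gcongr)
        _ = R * (X ^ (10000 : ℝ) * Real.exp (10000 * Real.pi)) * A k * P := by
            rw [hA]; field_simp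
        _ ≤ R * (X ^ (10000 : ℝ) * Real.exp (10000 * Real.pi)) * A k * (2 * diamTract φ R) := by
            gcongr
        _ = _ := by rw [hW]; ring
    refine h5.trans (Finset.single_le_sum (f := fun k => (I k).indicator
      (fun _ => W ^ t * A k ^ t) y) (fun j _ => indicator_nonneg (fun _ _ => hB j) _) hkS)
  have hI' := fun k : ℤ => intervalIntegral_indicator_Icc_le hab (hcd k) (hB k)
  have hint : IntervalIntegrable (fun y => gSpeed φ R y ^ t) MeasureTheory.volume a b :=
    ((h.continuous_gSpeed R).rpow_const fun _ => Or.inr ht).intervalIntegrable _ _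
  have hsumint : IntervalIntegrable (fun y => ∑ k ∈ S, (I k).indicator
      (fun _ => W ^ t * A k ^ t) y) MeasureTheory.volume a b := by
    have := IntervalIntegrable.sum S fun k _ => (hI' k).1
    rwa [show (∑ k ∈ S, (I k).indicator fun _ => W ^ t * A k ^ t) = fun y =>
      ∑ k ∈ S, (I k).indicator (fun _ => W ^ t * A k ^ t) y from
      funext fun y => Finset.sum_apply _ _ _] at this
  rw [h.segMean_eq hR0]
  calc ∫ y in a..b, gSpeed φ R y ^ t
      ≤ ∫ y in a..b, ∑ k ∈ S, (I k).indicator (fun _ => W ^ t * A k ^ t) y :=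
        intervalIntegral.integral_mono_on hab hint hsumint hpt
    _ = ∑ k ∈ S, ∫ y in a..b, (I k).indicator (fun _ => W ^ t * A k ^ t) y :=
        intervalIntegral.integral_finsetSum fun k _ => (hI' k).1
    _ ≤ ∑ k ∈ S, 2 * Real.pi / R * W ^ t * A k ^ t := by
        refine Finset.sum_le_sum fun k _ => (hI' k).2.trans (le_of_eq ?_)
        ring
    _ = _ := by rw [Finset.mul_sum]

/-- Because log P ≤ 10002 log R, the left side is R^{t-1} times a power of log R, and R^ε absorbs
the latter. K will be the number of covering discs times c^{-t}. -/
theorem eventually_weight_le (hb : TractBounds φ M m α R₀) {t ε : ℝ} (ht : 0 ≤ t) (hε : 0 < ε)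
    (K : ℝ) (hK : 0 ≤ K) : ∀ᶠ R in atTop,
      2 * Real.pi / R * (2 * R * (Real.log (tractScale φ R) ^ (10000 : ℝ) *
        Real.exp (10000 * Real.pi))) ^ t * K ≤ R ^ (t - 1 + ε) := by
  set E := 2 * (10002 : ℝ) ^ (10000 : ℝ) * Real.exp (10000 * Real.pi) with hE
  have hE0 : 0 < E := by positivity
  set B := 2 * Real.pi * E ^ t * K with hB
  have hB0 : 0 ≤ B := by positivity
  have hlo := (isLittleO_log_rpow_rpow_atTop (10000 * t) hε).bound
    (c := (B + 1)⁻¹) (by positivity)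
  have e1 : ∀ᶠ R in atTop, 0 ≤ Real.log (tractScale φ R) :=
    (Real.tendsto_log_atTop.comp hb.tendsto).eventually_ge_atTop _
  filter_upwards [hlo, e1, eventually_ge_atTop R₀] with R h1 h2 hR
  have hR1 : 1 < R := hb.one_lt.trans_le hR
  have hR0 : 0 < R := by linarith
  have hl := Real.log_pos hR1
  have hP := hb.scale_pos R hR
  rw [Real.norm_eq_abs, Real.norm_eq_abs, abs_of_nonneg (by positivity),
    abs_of_nonneg (by positivity)] at h1
  have h3 : Real.log (tractScale φ R) ≤ 10002 * Real.log R := by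
    have := Real.log_le_log hP (hb.scale_le R hR)
    rwa [Real.log_rpow hR0] at this
  have h4 : 2 * R * (Real.log (tractScale φ R) ^ (10000 : ℝ) * Real.exp (10000 * Real.pi)) ≤
      E * R * Real.log R ^ (10000 : ℝ) := by
    calc _ ≤ 2 * R * ((10002 * Real.log R) ^ (10000 : ℝ) * Real.exp (10000 * Real.pi)) := by
          gcongr
      _ = _ := by rw [Real.mul_rpow (by norm_num) hl.le, hE]; ring
  have h5 : (E * R * Real.log R ^ (10000 : ℝ)) ^ t = E ^ t * R ^ t * Real.log R ^ (10000 * t) := by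
    rw [Real.mul_rpow (by positivity) (by positivity), Real.mul_rpow hE0.le hR0.le,
      ← Real.rpow_mul hl.le]
  calc _ ≤ 2 * Real.pi / R * (E * R * Real.log R ^ (10000 : ℝ)) ^ t * K := by gcongr
    _ = B * Real.log R ^ (10000 * t) * (R ^ t / R) := by rw [h5, hB]; ring
    _ ≤ (B + 1) * ((B + 1)⁻¹ * R ^ ε) * (R ^ t / R) := by
        gcongr
        linarith
    _ = R ^ ε * (R ^ t / R) := by rw [mul_inv_cancel_left₀ (by positivity)]
    _ = _ := by
        rw [Real.rpow_add hR0, Real.rpow_sub_one hR0.ne']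
        ring

/-- A mean above R^{t-1+ε} makes Σ A_k^t exceed N c^{-t}, with N the number of discs covering the
annulus. Some disc then collects more than c^{-t}, which is exactly what the dimension bound for its
branch system needs. -/
theorem exists_repeller_of_frequently (hb : TractBounds φ M m α R₀) (h : IsTractModel Ω τ φ)
    (hl : 0 < lam) (hf : ∀ z ∈ Ω, f z = lam * Complex.exp (τ z)) {t ε : ℝ} (ht : 0 < t)
    (hε : 0 < ε) (hfr : ∃ᶠ R in atTop, R ^ (t - 1 + ε) < meanI φ R t) :
    ∃ X, IsExpandingRepeller f Ω X ∧ ENNReal.ofReal t ≤ dimH X := by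
  obtain ⟨c, hc, hsys⟩ := hb.eventually_isBranchSystem h hl hf
  have hm := hb.m_pos
  have hM := hb.one_le_M
  have hκ0 := kappa_pos
  have hκ1 := kappa_lt_one
  have hπ4 := Real.pi_le_four
  have hπ := Real.pi_pos
  have hcomp : IsCompact {w : ℂ | m ≤ ‖w‖ ∧ ‖w‖ ≤ M} := by
    refine (isCompact_closedBall (0 : ℂ) M).of_isClosed_subset ?_ fun w hw => by simpa using hw.2
    exact (isClosed_le continuous_const continuous_norm).inter
      (isClosed_le continuous_norm continuous_const)
  -- The annulus is normalised by P, so this finite cover is chosen before R.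
  obtain ⟨T, hTA, hTfin, hTcov⟩ := hcomp.finite_cover_balls (e := m / 8) (by positivity)
  have e1 : ∀ᶠ R in atTop, 1 ≤ Real.log (tractScale φ R) :=
    (Real.tendsto_log_atTop.comp hb.tendsto).eventually_ge_atTop _
  have e2 := hb.eventually_weight_le ht.le hε (hTfin.toFinset.card * (c ^ t)⁻¹) (by positivity)
  have e3 : ∀ᶠ R : ℝ in atTop, 10002 * Real.log R ≤ 1 / 2 * R := by
    have := Real.isLittleO_log_id_atTop.bound (c := 1 / 20004) (by norm_num)
    filter_upwards [this, eventually_ge_atTop 1] with R h1 h2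
    rw [Real.norm_eq_abs, Real.norm_eq_abs, id, abs_of_nonneg (by linarith : 0 ≤ R)] at h1
    linarith [le_abs_self (Real.log R)]
  obtain ⟨R, hRfr, hRsys, hX, hK, hlog, hR, hR8, hR5⟩ := (hfr.and_eventually
    (hsys.and (e1.and (e2.and (e3.and ((eventually_ge_atTop R₀).and
      ((eventually_ge_atTop (8 / kappa)).and (eventually_ge_atTop 5)))))))).exists
  have hR0 : 0 < R := by linarith
  have hP := hb.scale_pos R hR
  have hXR : Real.log (tractScale φ R) ≤ 1 / 2 * R := by
    have := Real.log_le_log hP (hb.scale_le R hR)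
    rw [Real.log_rpow hR0] at this
    linarith
  obtain ⟨S, hS, hSsum⟩ : ∃ S : Finset ℤ, (∀ k ∈ S, kappa * R - Real.pi ≤ |2 * Real.pi * k| ∧
        |2 * Real.pi * k| ≤ R + Real.pi) ∧
      R ^ (t - 1 + ε) < 2 * Real.pi / R * (2 * R * (Real.log (tractScale φ R) ^ (10000 : ℝ) *
        Real.exp (10000 * Real.pi))) ^ t *
        ∑ k ∈ S, (‖deriv φ (gridPoint (tractScale φ R) k)‖ / tractScale φ R) ^ t := by
    rcases lt_max_iff.1 hRfr with h1 | h1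
    · obtain ⟨S, hS, h2⟩ := hb.segMean_le_sum h hR hX (a := -1) (b := -kappa) (by linarith) le_rfl
        (by linarith) (fun y hy => by
          rw [abs_of_nonpos (by linarith [hy.2])]; linarith [hy.2]) ht.le
      exact ⟨S, hS, h1.trans_le h2⟩
    · obtain ⟨S, hS, h2⟩ := hb.segMean_le_sum h hR hX (a := kappa) (b := 1) hκ1.le (by linarith)
        le_rfl (fun y hy => hy.1.trans (le_abs_self y)) ht.le
      exact ⟨S, hS, h1.trans_le h2⟩
  set P := tractScale φ R with hPdef
  set A : ℤ → ℝ := fun k => ‖deriv φ (gridPoint P k)‖ / P with hA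
  have hsum : hTfin.toFinset.card * (c ^ t)⁻¹ < ∑ k ∈ S, A k ^ t :=
    lt_of_mul_lt_mul_left (hK.trans_lt hSsum) (by positivity)
  have hgm : ∀ k, gridPoint P k ∈ rightHalfPlane := fun k => by
    change 0 < Real.log P
    linarith
  have hA0 : ∀ k, 0 < A k := fun k => div_pos (h.norm_deriv_pos (hgm k)) hP
  have hcov : ∀ k ∈ S, ∃ w ∈ T, ‖φ (gridPoint P k) / P - w‖ < m / 8 := by
    intro k hk
    obtain ⟨h1, h2⟩ := hS k hk
    have h3 := abs_le.1 h2
    have hQ : gridPoint P k ∈ Q (2 * R) := by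
      refine ⟨hgm k, ?_, ?_, ?_⟩
      · change Real.log P < _
        linarith
      · change -(2 * R) < 2 * Real.pi * k
        linarith
      · change 2 * Real.pi * k < 2 * R
        linarith
    -- κR ≥ 8 ensures κR - π ≥ κR/2, the height at which the lower bound on |φ| is available.
    rw [div_le_iff₀' hκ0] at hR8
    have h4 := hb.le_norm R hR _ hQ (by
      change _ ≤ |2 * Real.pi * k|
      linarith)
    have h5 := hb.norm_le R hR _ hQ
    have h6 : φ (gridPoint P k) / P ∈ {w : ℂ | m ≤ ‖w‖ ∧ ‖w‖ ≤ M} := by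
      rw [mem_ofPred_eq, norm_div, Complex.norm_real, Real.norm_eq_abs, abs_of_pos hP,
        le_div_iff₀ hP, div_le_iff₀ hP]
      exact ⟨h4, h5⟩
    obtain ⟨w, hw, hw'⟩ := mem_iUnion₂.1 (hTcov h6)
    exact ⟨w, hw, mem_ball_iff_norm.1 hw'⟩
  choose! j hjT hj using hcov
  have hfib := Finset.sum_fiberwise_of_maps_to (s := S) (t := hTfin.toFinset) (g := j)
    (fun k hk => hTfin.mem_toFinset.2 (hjT k hk)) (fun k => A k ^ t)
  rw [← hfib, ← nsmul_eq_mul, ← Finset.sum_const] at hsum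
  obtain ⟨w, hw, hwsum⟩ := Finset.exists_lt_of_sum_lt hsum
  have hwA := hTA (hTfin.mem_toFinset.1 hw)
  set S' := S.filter fun k => j k = w with hS'
  have hS'ne : S'.Nonempty := by
    by_contra hne
    rw [Finset.not_nonempty_iff_eq_empty] at hne
    rw [hne, Finset.sum_empty] at hwsum
    have : 0 < (c ^ t)⁻¹ := by positivity
    linarith
  have hwn : ‖w * P‖ = ‖w‖ * P := by
    rw [norm_mul, Complex.norm_real, Real.norm_eq_abs, abs_of_pos hP]
  obtain ⟨hbs, hlow⟩ := hRsys S' (w * P) hS'ne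
    (by rw [hwn]; exact mul_le_mul_of_nonneg_right hwA.1 hP.le)
    (by rw [hwn]; exact mul_le_mul_of_nonneg_right hwA.2 hP.le)
    (fun k hk => (hS k (Finset.mem_filter.1 hk).1).2) (by
      intro k hk
      obtain ⟨hk1, hk2⟩ := Finset.mem_filter.1 hk
      have h1 := hj k hk1
      rw [hk2] at h1
      have hPc : (P : ℂ) ≠ 0 := Complex.ofReal_ne_zero.2 hP.ne'
      have e : φ (gridPoint P k) - w * P = (φ (gridPoint P k) / P - w) * P := by field_simp
      rw [e, norm_mul, Complex.norm_real, Real.norm_eq_abs, abs_of_pos hP]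
      nlinarith)
  refine ⟨_, hbs.isExpandingRepeller, hbs.le_dimH ht (s := fun k => c * A k)
    (fun k _ => mul_pos hc (hA0 k)) hlow ?_⟩
  have : ∑ k ∈ S', (c * A k) ^ t = c ^ t * ∑ k ∈ S', A k ^ t := by
    rw [Finset.mul_sum]
    exact Finset.sum_congr rfl fun k _ => Real.mul_rpow hc.le (hA0 k).le
  rw [this]
  have hct : 0 < c ^ t := by positivity
  rw [← inv_mul_le_iff₀ hct, mul_one]
  exact hwsum.le

theorem eventually_meanI_pos (hb : TractBounds φ M m α R₀) (h : IsTractModel Ω τ φ) {t : ℝ}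
    (ht : 0 ≤ t) : ∀ᶠ R in atTop, 0 < meanI φ R t := by
  have hκ1 := kappa_lt_one
  filter_upwards [hb.eventually_segMean_bounds h, eventually_gt_atTop 0] with R h1 hR0
  have h2 := (h1 kappa 1 (by linarith [kappa_pos]) hκ1.le le_rfl 0 t ht).1
  refine lt_of_lt_of_le ?_ (h2.trans (le_max_right _ _))
  have h3 : segMean φ R 0 kappa 1 = 1 - kappa := by simp [segMean]
  rw [h3]
  have : 0 < 1 - kappa := by linarith
  positivity

theorem frequently_lt_meanI (hb : TractBounds φ M m α R₀) (h : IsTractModel Ω τ φ) {t x y : ℝ}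
    (ht : 0 ≤ t) (hx : betaInf φ t = x) (hy : y < x) :
    ∃ᶠ R in atTop, R ^ y < meanI φ R t := by
  have hlt : (y : EReal) < limsup (fun R : ℝ => ((betaR φ R t : ℝ) : EReal)) atTop := by
    change _ < betaInf φ t
    rw [hx]
    exact_mod_cast hy
  have hfr := frequently_lt_of_lt_limsup (by isBoundedDefault) hlt
  refine (hfr.and_eventually ((eventually_gt_atTop 1).and (hb.eventually_meanI_pos h ht))).mono ?_
  rintro R ⟨h1, hR, hpos⟩
  have h1' : y < betaR φ R t := by exact_mod_cast h1
  have hR0 : 0 < R := by linarith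
  rw [betaR, lt_div_iff₀ (Real.log_pos hR), ← Real.log_rpow hR0] at h1'
  exact (Real.log_lt_log_iff (by positivity) hpos).1 h1'

end TractBounds

theorem ofReal_le_of_forall_lt {Θ : ℝ} {s : ENNReal} (hΘ : 0 < Θ)
    (h : ∀ t, 0 < t → t < Θ → ENNReal.ofReal t ≤ s) : ENNReal.ofReal Θ ≤ s := by
  refine le_of_forall_lt fun a ha => ?_
  have hane : a ≠ ⊤ := ha.ne_top
  rw [ENNReal.lt_ofReal_iff_toReal_lt hane] at ha
  have h0 : 0 ≤ a.toReal := ENNReal.toReal_nonneg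
  refine lt_of_lt_of_le ?_ (h ((a.toReal + Θ) / 2) (by linarith) (by linarith))
  rw [ENNReal.lt_ofReal_iff_toReal_lt hane]
  linarith

theorem notMem_poles_of_eqOn {Ω : Set ℂ} {f τ : ℂ → ℂ} {lam : ℂ} (hΩ : IsOpen Ω)
    (hτ : DifferentiableOn ℂ τ Ω) (hf : ∀ z ∈ Ω, f z = lam * Complex.exp (τ z)) :
    Ω ⊆ (poles f)ᶜ := by
  intro z hz
  have hd : DifferentiableOn ℂ f Ω := (hτ.cexp.const_mul lam).congr hf
  exact not_lt.2 (hd.analyticAt (hΩ.mem_nhds hz)).meromorphicOrderAt_nonneg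

theorem IsExpandingRepeller.mono {f : ℂ → ℂ} {D D' X : Set ℂ} (h : IsExpandingRepeller f D X)
    (hD : D ⊆ D') : IsExpandingRepeller f D' X := by
  obtain ⟨U, h1, h2, h3, h4⟩ := h.isolated
  exact ⟨h.isCompact, h.nonempty, h.image_eq, h.expanding, U, h1, h2, h3.trans hD, h4⟩

end HolderTract

/-! ### The theorem -/

open HolderTract
theorem theorem4p1 (Ω : Set ℂ) (τ φ : ℂ → ℂ) (hτ : IsTractModel Ω τ φ) (hH : IsHolder φ) :
    ∃ Θ : ℝ,
      (0 ≤ Θ ∧ betaInf φ Θ - (Θ : EReal) + 1 = 0 ∧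
        ∀ t : ℝ, 0 ≤ t → betaInf φ t - (t : EReal) + 1 = 0 → t = Θ) ∧
      1 ≤ Θ ∧
      (∀ (f : ℂ → ℂ) (R : ℝ), IsTranscendentalMeromorphic f → IsLogarithmicTract f Ω R →
        (∀ z ∈ Ω, f z = (R : ℂ) * Complex.exp (τ z)) → ENNReal.ofReal Θ ≤ hypDim f) ∧
      ENNReal.ofReal Θ ≤ localHypDim (fun z => Complex.exp (τ z)) Ω := by
  obtain ⟨M, m, α, R₀, hb⟩ := hτ.exists_tractBounds hH
  obtain ⟨β, hβ, hβ0, hβb⟩ := hb.exists_beta hτ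
  have hα := hb.alpha_pos
  have hcoe : ∀ t, 0 ≤ t →
      betaInf φ t - (t : EReal) + 1 = ((β t - t + 1 : ℝ) : EReal) := by
    intro t ht
    rw [hβ t ht]
    norm_cast
  have hstep : ∀ t t' : ℝ, 0 ≤ t → t ≤ t' →
      (β t - t + 1) - 10002 * (t' - t) ≤ β t' - t' + 1 ∧
      β t' - t' + 1 ≤ (β t - t + 1) - α / 2 * (t' - t) := by
    intro t t' ht htt
    obtain ⟨h1, h2⟩ := hβb t t' ht htt
    constructor <;> linarith
  obtain ⟨Θ, hΘ0, hΘz, hΘu⟩ := exists_unique_zero (b := fun t => β t - t + 1)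
    (half_pos hα) (by simp [hβ0]) hstep
  have h1 : 0 ≤ β 1 := hb.beta_one_nonneg hτ (hβ 1 zero_le_one)
  have hΘ1 : 1 ≤ Θ := by
    by_contra hlt
    push Not at hlt
    have := (hstep Θ 1 hΘ0 hlt.le).2
    nlinarith [mul_pos (half_pos hα) (sub_pos.2 hlt)]
  have hmain : ∀ (f : ℂ → ℂ) (lam : ℝ), 0 < lam → (∀ z ∈ Ω, f z = lam * Complex.exp (τ z)) →
      ∀ t, 0 < t → t < Θ → ∃ X, IsExpandingRepeller f Ω X ∧ ENNReal.ofReal t ≤ dimH X := by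
    intro f lam hl hf t ht htΘ
    -- Strict decrease up to the zero Θ. Half of this gap serves as ε, so that t - 1 + ε is still
    -- below β_∞(t).
    have hpos : 0 < β t - t + 1 := by
      have := (hstep t Θ ht.le htΘ.le).2
      nlinarith [mul_pos (half_pos hα) (sub_pos.2 htΘ)]
    exact hb.exists_repeller_of_frequently hτ hl hf ht (half_pos hpos)
      (hb.frequently_lt_meanI hτ ht.le (hβ t ht.le) (by linarith))
  refine ⟨Θ, ⟨hΘ0, ?_, fun t ht htz => hΘu t ht ?_⟩, hΘ1, ?_, ?_⟩
  · rw [hcoe Θ hΘ0, hΘz, EReal.coe_zero]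
  · rw [hcoe t ht] at htz
    exact_mod_cast htz
  · intro f R hf hR hfτ
    refine ofReal_le_of_forall_lt (by linarith) fun t ht htΘ => ?_
    obtain ⟨X, hX, hdim⟩ := hmain f R hR.pos hfτ t ht htΘ
    refine hdim.trans (le_iSup₂_of_le X ⟨hX.mono ?_, hX.subset_julia hf.1⟩ le_rfl)
    exact notMem_poles_of_eqOn hτ.isOpen hτ.holo hfτ
  · refine ofReal_le_of_forall_lt (by linarith) fun t ht htΘ => ?_
    obtain ⟨X, hX, hdim⟩ := hmain (fun z => Complex.exp (τ z)) 1 one_pos (by simp) t ht htΘ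
    exact hdim.trans (le_iSup₂_of_le X hX le_rfl)
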